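/- Let $d\ge 1$ and let $V:\mathbb R^d\to\mathbb R$ be locally integrable with negative part $V_-$ form-bounded relative to $-\Delta$ with relative bound less than $1$, i.e. $\int V_-|\psi|^2\le a\int|\nabla\psi|^2+b\int|\psi|^2$ for all $\psi\in H^1(\mathbb R^d)$, with some $a<1$, $b\ge 0$ (for instance, $V$ bounded from below). For $\psi\in L^2(\mathbb R^d;\mathbb C)$ let $E[\psi]=\int_{\mathbb R^d}(|\nabla\psi|^2+V|\psi|^2)\,dx$ if $\psi\in H^1(\mathbb R^d)$ and $V|\psi|^2\in L^1(\mathbb R^d)$, and $E[\psi]=+\infty$ otherwise, and let $H_V=-\Delta+V$ be the self-adjoint operator associated with this quadratic form. Let $$\lambda_i(V)=\inf_{\substack{F\subset L^2(\mathbb R^d)\\ \dim F=i}}\ \sup_{\psi\in F,\ \|\psi\|_{L^2}=1}E[\psi],\qquad i\in\mathbb N^*=\{1,2,\dots\}.$$ Let $\beta:\mathbb R\to(-\infty,+\infty]$ be strictly convex on its effective domain $D=\{\beta<\infty\}$, with $0\in D\subset[0,\infty)$, $\beta(0)=0$ and $\beta\in C^1(\mathrm{int}\,D)$. Assume **(H)**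 $-\Delta+V$ has the unbounded sequence of eigenvalues $(\lambda_i(V))_{i\in\mathbb N^*}$, counted with multiplicity, with an orthonormal sequence of eigenfunctions $\bar\psi=(\bar\psi_i)$, $H_V\bar\psi_i=\lambda_i(V)\bar\psi_i$; the numbers $\bar\nu_i=(\beta')^{-1}(-\lambda_i(V))\in D$ are defined, in the sense that $-\lambda_i(V)$ belongs to the subdifferential of $\beta$ at $\bar\nu_i$ (which means $\beta'(\bar\nu_i)=-\lambda_i(V)$ when $\bar\nu_i\in\mathrm{int}\,D$); and the series $\sum_i\beta(\bar\nu_i)$ and $\sum_i\bar\nu_i\lambda_i(V)$ converge absolutely. Assume moreover that, for some $p\in[1,2]$, $\beta$ is twice differentiable on $\mathrm{int}\,D$ and $\alpha:=\inf_{s\in\mathrm{int}\,D}\beta''(s)\,s^{2-p}>0$. Let $\nu=(\nu_i)_{i\in\mathbb N^*}$ be a nonincreasing sequence of nonnegative numbers converging to $0$ such that $\sum_i\beta(\nu_i)$ converges absolutely, and let $\psi^0=(\psi^0_i)_{i\in\mathbb N^*}$ be an orthonormal sequence in $L^2(\mathbb R^d;\mathbb C)$ such that the free energy $\mathcal F[\nu,\psi^0]=\sum_i\beta(\nu_i)+\sum_i\nu_iE[\psi^0_i]$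 is finite (convention $0\cdot\infty=0$). For each $j$ let $\psi_j\in C([0,\infty);L^2(\mathbb R^d))$ be the weak solution of the linear Schrödinger equation $i\,\partial_t\psi_j=H_V\psi_j$, $t>0$, with $\psi_j(0)=\psi^0_j$, that is, $\frac{d}{dt}\langle\varphi,\psi_j(t)\rangle=-i\langle H_V\varphi,\psi_j(t)\rangle$ for all $\varphi$ in the domain of $H_V$ and all $t>0$. Then for every $t>0$ $$2^{-2/p}\,\alpha\,\|\nu-\bar\nu\|_{\ell^p}^2\,\min\left\{\|\nu\|_{\ell^p}^{p-2},\|\bar\nu\|_{\ell^p}^{p-2}\right\}+\sum_{i\in\mathbb N^*}\nu_i\left(E[\psi_i(t)]-\lambda_i(V)\right)\ \le\ \mathcal F[\nu,\psi^0]-\mathcal F[\bar\nu,\bar\psi],$$ where all the $\ell^p$ norms are finite, $\mathcal F[\bar\nu,\bar\psi]$ is finite, the series converges absolutely, and both terms on the left-hand side are nonnegative. (For $p<2$, $0^{p-2}=+\infty$ and $0\cdot\infty=0$.) -/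

import Mathlib

open MeasureTheory Set Filter Topology
open scoped ENNReal NNReal SchwartzMap LineDeriv

noncomputable section

namespace MixedStates

/-- Euclidean space `ℝ^d`. -/
abbrev Space (d : ℕ) : Type := EuclideanSpace ℝ (Fin d)

/-- The complex Hilbert space `L²(ℝ^d)` of wave functions. -/
abbrev L2 (d : ℕ) : Type := Lp ℂ 2 (volume : Measure (Space d))

/-! ### The Schrödinger operator `H_V = -Δ + V` and its energy -/

section Operator

variable {d : ℕ}

/-- `g ∈ L²` is the weak partial derivative `∂ψ/∂x_k` of `ψ ∈ L²`
(equality of tempered distributions). -/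
def IsWeakPartial (k : Fin d) (ψ g : L2 d) : Prop :=
  ∂_{(EuclideanSpace.single k (1 : ℝ) : Space d)} (Lp.toTemperedDistribution ψ) =
    Lp.toTemperedDistribution g

/-- `ψ ∈ H¹(ℝ^d)`: all first weak partial derivatives are in `L²`. -/
def MemH1 (ψ : L2 d) : Prop := ∀ k : Fin d, ∃ g : L2 d, IsWeakPartial k ψ g

open Classical in
/-- The weak partial derivative `∂ψ/∂x_k` in `L²` (and `0` if there is none). -/
def weakPartial (k : Fin d) (ψ : L2 d) : L2 d :=
  if h : ∃ g : L2 d, IsWeakPartial k ψ g then h.choose else 0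

/-- The potentials for which `-Δ + V` is defined as a semibounded self-adjoint operator through its
closed quadratic form: `V` is real and locally integrable, and its negative part is form bounded
relative to `-Δ` with relative bound less than one. Every locally integrable potential that is
bounded from below qualifies (with `a = 0`). -/
structure IsAdmissiblePotential (V : Space d → ℝ) : Prop where
  locallyIntegrable : LocallyIntegrable V volume
  negPart_formBounded : ∃ a b : ℝ≥0, a < 1 ∧ ∀ ψ : L2 d, MemH1 ψ →
    ∫⁻ x, ENNReal.ofReal (-V x) * ‖ψ x‖ₑ ^ 2 ≤
      (a : ℝ≥0∞) * ∑ k, ‖weakPartial k ψ‖ₑ ^ 2 + (b : ℝ≥0∞) * ‖ψ‖ₑ ^ 2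

/-- The form domain `{ψ ∈ H¹ : V |ψ|² ∈ L¹}`. -/
def formDomain (V : Space d → ℝ) : Set (L2 d) :=
  {ψ | MemH1 ψ ∧ Integrable (fun x => V x * ‖ψ x‖ ^ 2) volume}

open Classical in
/-- The energy `E[ψ] = ∫ (|∇ψ|² + V |ψ|²) dx`, with value `+∞` off the form domain. -/
def energy (V : Space d → ℝ) (ψ : L2 d) : EReal :=
  if ψ ∈ formDomain V then
    ((∑ k, ‖weakPartial k ψ‖ ^ 2 + ∫ x, V x * ‖ψ x‖ ^ 2 : ℝ) : EReal)
  else ⊤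

/-- The sesquilinear form `∫ (conj ∇χ · ∇ψ + V conj χ ψ) dx`. -/
def energyForm (V : Space d → ℝ) (χ ψ : L2 d) : ℂ :=
  ∑ k, inner ℂ (weakPartial k χ) (weakPartial k ψ) +
    ∫ x, (V x : ℂ) * (starRingEnd ℂ (χ x) * ψ x)

/-- The graph of the operator `H_V = -Δ + V` associated with the form:
`φ` is in the operator domain and `H_V φ = f`. -/
def IsHamiltonian (V : Space d → ℝ) (φ f : L2 d) : Prop :=
  φ ∈ formDomain V ∧ ∀ χ ∈ formDomain V, energyForm V χ φ = inner ℂ χ f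

/-- The min-max value `inf_{dim F = i + 1} sup_{ψ ∈ F, ‖ψ‖ = 1} E[ψ]`, as an extended real. -/
def minMax (V : Space d → ℝ) (i : ℕ) : EReal :=
  ⨅ (F : Submodule ℂ (L2 d)) (_ : Module.finrank ℂ F = i + 1),
    ⨆ (ψ : L2 d) (_ : ψ ∈ F) (_ : ‖ψ‖ = 1), energy V ψ

/-- The `i`-th min-max value, indexed from `0`, as a real number. -/
def eigenvalue (V : Space d → ℝ) (i : ℕ) : ℝ := (minMax V i).toReal

/-- `-Δ + V` has the unbounded sequence of eigenvalues `eigenvalue V i`, counted with multiplicity,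
and `ψbar` is an orthonormal sequence of associated eigenfunctions. -/
structure IsEigenSequence (V : Space d → ℝ) (ψbar : ℕ → L2 d) : Prop where
  orthonormal : Orthonormal ℂ ψbar
  eigenfunction : ∀ i, IsHamiltonian V (ψbar i) ((eigenvalue V i : ℂ) • ψbar i)
  unbounded : ¬ BddAbove (range (eigenvalue V))

/-- `ψ : t ↦ ψ(t) ∈ L²` solves `i ∂ₜψ = H_V ψ` for `t > 0` with `ψ(0) = ψ0`, in the weak sense:
it is continuous on `[0, ∞)` with values in `L²`, and
`d/dt ⟨φ, ψ(t)⟩ = -i ⟨H_V φ, ψ(t)⟩` for every `φ` in the domain of `H_V`. -/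
structure IsSchrodingerSolution (V : Space d → ℝ) (ψ0 : L2 d) (ψ : ℝ → L2 d) : Prop where
  continuousOn : ContinuousOn ψ (Ici 0)
  initial : ψ 0 = ψ0
  equation : ∀ φ f : L2 d, IsHamiltonian V φ f → ∀ t : ℝ, 0 < t →
    HasDerivAt (fun s : ℝ => inner ℂ φ (ψ s)) (-Complex.I * inner ℂ f (ψ t)) t

end Operator

/-! ### The convex function `β` -/

/-- A convex function `β` with `β = +∞` on `(-∞, 0)` is represented by its effective domain
`D ⊆ [0, ∞)` (the set where it is finite) and by its values on `D`. It is strictly convex,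
`β(0) = 0`, and `β` is `C¹` on the interior of `D`. -/
structure IsEntropyFunction (D : Set ℝ) (β : ℝ → ℝ) : Prop where
  nonneg : D ⊆ Ici 0
  zero_mem : (0 : ℝ) ∈ D
  map_zero : β 0 = 0
  strictConvex : StrictConvexOn ℝ D β
  contDiff : ContDiffOn ℝ 1 β (interior D)

/-- `s = (β')⁻¹(y)`, with `β'` the (maximal monotone) subdifferential of the extended-valued convex
function `β`: at an interior point of `D` this says `β'(s) = y`, see
`isDerivInverse_iff_deriv_eq`; at the endpoint `0` it means that `y` lies at or below the slope
of `β` at `0`. -/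
def IsDerivInverse (D : Set ℝ) (β : ℝ → ℝ) (y s : ℝ) : Prop :=
  s ∈ D ∧ ∀ r ∈ D, β s + y * (r - s) ≤ β r

theorem isDerivInverse_iff_deriv_eq {D : Set ℝ} {β : ℝ → ℝ} (hβ : IsEntropyFunction D β)
    {y s : ℝ} (hs : s ∈ interior D) : IsDerivInverse D β y s ↔ deriv β s = y := by
  have hsD : s ∈ D := interior_subset hs
  have hd : DifferentiableAt ℝ β s :=
    ((hβ.contDiff.differentiableOn (by norm_num)) s hs).differentiableAt
      (isOpen_interior.mem_nhds hs)
  constructor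
  · rintro ⟨_, h⟩
    have hmin : IsLocalMin (fun r => β r - y * r) s := by
      filter_upwards [mem_interior_iff_mem_nhds.1 hs] with r hr
      have := h r hr
      linarith
    have hder : HasDerivAt (fun r => β r - y * r) (deriv β s - y * 1) s :=
      hd.hasDerivAt.sub ((hasDerivAt_id s).const_mul y)
    have := hmin.hasDerivAt_eq_zero hder
    linarith
  · rintro rfl
    refine ⟨hsD, fun r hr => ?_⟩
    rcases lt_trichotomy s r with h | h | h
    · have := hβ.strictConvex.convexOn.deriv_le_slope hsD hr h hd
      rw [slope_def_field, le_div_iff₀ (by linarith)] at this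
      linarith
    · subst h; simp
    · have := hβ.strictConvex.convexOn.slope_le_deriv hr hsD h hd
      rw [slope_def_field, div_le_iff₀ (by linarith)] at this
      linarith

/-- `α = inf β''(s) s^{2-p}`, the infimum being over the `s > 0` in the interior of the effective
domain of `β`, on which `β` is twice differentiable. -/
structure IsConvexityConstant (D : Set ℝ) (β : ℝ → ℝ) (p α : ℝ) : Prop where
  differentiable_deriv : ∀ s ∈ interior D, DifferentiableAt ℝ (deriv β) s
  isGLB : IsGLB ((fun s : ℝ => deriv (deriv β) s * s ^ (2 - p)) '' interior D) α

/-! ### Mixed states and the free energy -/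

section FreeEnergy

variable {d : ℕ}

/-- Assumption (H) on `β` and `V`, with `ψbar` the eigenfunctions of `-Δ + V` and
`νbar i = (β')⁻¹(-λ_i(V))`. -/
structure AssumptionH (D : Set ℝ) (β : ℝ → ℝ) (V : Space d → ℝ)
    (νbar : ℕ → ℝ) (ψbar : ℕ → L2 d) : Prop where
  entropy : IsEntropyFunction D β
  potential : IsAdmissiblePotential V
  eigenSequence : IsEigenSequence V ψbar
  occupation : ∀ i, IsDerivInverse D β (-eigenvalue V i) (νbar i)
  summable_entropy : Summable fun i => β (νbar i)
  summable_energy : Summable fun i => νbar i * eigenvalue V i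

/-- The set `S` of nonincreasing sequences of occupation numbers in `[0, ∞)` converging to `0` such
that `∑ β(ν_i)` is absolutely convergent (in particular `β(ν_i) < ∞` for all `i`). -/
def occupationNumbers (D : Set ℝ) (β : ℝ → ℝ) : Set (ℕ → ℝ) :=
  {ν | Antitone ν ∧ (∀ i, 0 ≤ ν i) ∧ Tendsto ν atTop (𝓝 0) ∧ (∀ i, ν i ∈ D) ∧
    Summable fun i => β (ν i)}

/-- The series `∑ ν_i E[ψ_i]` (with `0 · ∞ = 0`) is finite. -/
def HasFiniteEnergy (V : Space d → ℝ) (ν : ℕ → ℝ) (ψ : ℕ → L2 d) : Prop :=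
  (∀ i, ν i ≠ 0 → energy V (ψ i) ≠ ⊤) ∧ Summable fun i => ν i * (energy V (ψ i)).toReal

/-- The free energy `F[ν, ψ] = ∑ β(ν_i) + ∑ ν_i E[ψ_i]` of a mixed state of finite energy. -/
def freeEnergy (β : ℝ → ℝ) (V : Space d → ℝ) (ν : ℕ → ℝ) (ψ : ℕ → L2 d) : ℝ :=
  ∑' i, β (ν i) + ∑' i, ν i * (energy V (ψ i)).toReal

end FreeEnergy

/-- The `ℓ^p` norm of a real sequence, with values in `[0, ∞]`. -/
def lpENorm (p : ℝ) (x : ℕ → ℝ) : ℝ≥0∞ := (∑' i, ‖x i‖ₑ ^ p) ^ (1 / p)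

/-- `2^{-2/p} α ‖ν - νbar‖² min {‖ν‖^{p-2}, ‖νbar‖^{p-2}}` with `ℓ^p` norms, computed in `[0, ∞]`
(so `0^{p-2} = ∞` if `p < 2`). -/
def entropyTerm (p α : ℝ) (ν νbar : ℕ → ℝ) : ℝ≥0∞ :=
  ENNReal.ofReal ((2 : ℝ) ^ (-2 / p) * α) * lpENorm p (fun i => ν i - νbar i) ^ 2 *
    min (lpENorm p ν ^ (p - 2)) (lpENorm p νbar ^ (p - 2))

end MixedStates

end

/-! With λ_i = λ_i(V), the free energy gap splits as Σ (β(ν_i) − β(ν̄_i) + λ_i (ν_i − ν̄_i)) + Σ ν_i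
(E[ψ⁰_i] − λ_i): a relative entropy, in which −λ_i is a subgradient of β at ν̄_i, and an energy
excess. The two are treated independently.

The energy excess is conserved. Each coefficient of a weak solution in the eigenbasis keeps its
modulus, and E[ψ] = Σ_k λ_k |⟨ψ̄_k, ψ⟩|² on the form domain. This expansion needs no spectral
theorem: the form is closed and densely defined, and a unit vector of the form domain orthogonal to
every ψ̄_k would bound all min-max values, against their unboundedness
(`IsClosedForm.eq_zero_of_orthogonal`, `IsClosedForm.mem_and_quad_eq`). The excess is nonnegative by
the Ky Fan inequality (`IsClosedForm.sum_eigenvalue_le`) and Abel summation, as ν is nonincreasing.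

For the relative entropy, Taylor's inequality with β''(s) ≥ α s^(p−2) bounds each term below by
(α/2) (ν_i − ν̄_i)² max(ν_i, ν̄_i)^(p−2) (`bregman_lower_bound`). A reversed Hölder inequality,
applied separately where ν_i > ν̄_i and where ν_i < ν̄_i, turns the sum into the ℓ^p bound
(`entropyTerm_le`). The same pointwise bound yields the finiteness of the ℓ^p norms. -/

namespace MixedStates

/-! ### Closed semibounded forms on a Hilbert space -/

section AbstractForm

variable {H : Type*} [NormedAddCommGroup H] [InnerProductSpace ℂ H]

/-- `q` is a closed Hermitian form with form domain `Q`, bounded from below by `-b`. -/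
structure IsClosedForm (Q : Submodule ℂ H) (q : H → H → ℂ) (b : ℝ) : Prop where
  conj_symm : ∀ x y, starRingEnd ℂ (q y x) = q x y
  add_right : ∀ x ∈ Q, ∀ y ∈ Q, ∀ z ∈ Q, q x (y + z) = q x y + q x z
  smul_right : ∀ x ∈ Q, ∀ y ∈ Q, ∀ c : ℂ, q x (c • y) = c * q x y
  lower_bound : ∀ x ∈ Q, -b * ‖x‖ ^ 2 ≤ (q x x).re
  closed : ∀ (u : ℕ → H) (x : H), (∀ n, u n ∈ Q) → Tendsto u atTop (𝓝 x) →
    (∀ ε > 0, ∃ N, ∀ n ≥ N, ∀ m ≥ n, (q (u m - u n) (u m - u n)).re < ε) →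
    x ∈ Q ∧ Tendsto (fun n => (q (u n) (u n)).re) atTop (𝓝 (q x x).re)

/-- `e` is an orthonormal family of eigenvectors of the operator associated with the form `q`. -/
structure IsEigenFamily {ι : Type*} (Q : Submodule ℂ H) (q : H → H → ℂ) (e : ι → H) (l : ι → ℝ) :
    Prop where
  orthonormal : Orthonormal ℂ e
  mem : ∀ k, e k ∈ Q
  eig : ∀ k, ∀ x ∈ Q, q x (e k) = l k * inner ℂ x (e k)

variable {Q : Submodule ℂ H} {q : H → H → ℂ} {b : ℝ}

namespace IsEigenFamily

variable {ι : Type*} {e : ι → H} {l : ι → ℝ} (he : IsEigenFamily Q q e l)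
include he

theorem sum_mem (s : Finset ι) (c : ι → ℂ) : ∑ k ∈ s, c k • e k ∈ Q :=
  Q.sum_mem fun k _ => Q.smul_mem _ (he.mem k)

theorem quad_eigen (k : ι) : (q (e k) (e k)).re = l k := by
  rw [he.eig k _ (he.mem k), inner_self_eq_norm_sq_to_K, he.orthonormal.1 k]
  simp

theorem comp_injective {κ : Type*} {f : κ → ι} (hf : Function.Injective f) :
    IsEigenFamily Q q (e ∘ f) (l ∘ f) :=
  ⟨he.orthonormal.comp f hf, fun _ => he.mem _, fun _ => he.eig _⟩

theorem norm_sum_sq (s : Finset ι) (c : ι → ℂ) :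
    ‖∑ k ∈ s, c k • e k‖ ^ 2 = ∑ k ∈ s, ‖c k‖ ^ 2 := by
  rw [← Complex.ofReal_inj, Complex.ofReal_pow]
  have := inner_self_eq_norm_sq_to_K (𝕜 := ℂ) (∑ k ∈ s, c k • e k)
  rw [he.orthonormal.inner_sum] at this
  refine this.symm.trans ?_
  push_cast
  refine Finset.sum_congr rfl fun k _ => ?_
  rw [mul_comm, Complex.mul_conj, Complex.normSq_eq_norm_sq]
  push_cast; rfl

end IsEigenFamily

namespace IsClosedForm

variable (hq : IsClosedForm Q q b)
include hq

theorem zero_right {x : H} (hx : x ∈ Q) : q x 0 = 0 := by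
  simpa using hq.smul_right x hx 0 Q.zero_mem 0

theorem sum_right {ι : Type*} (s : Finset ι) {x : H} (hx : x ∈ Q) {v : ι → H} (hv : ∀ i, v i ∈ Q)
    (c : ι → ℂ) : q x (∑ i ∈ s, c i • v i) = ∑ i ∈ s, c i * q x (v i) := by
  classical
  induction s using Finset.induction_on with
  | empty => simpa using hq.zero_right hx
  | insert a s ha ih =>
    rw [Finset.sum_insert ha, Finset.sum_insert ha, hq.add_right x hx _ (Q.smul_mem _ (hv a)) _
      (Q.sum_mem fun i _ => Q.smul_mem _ (hv i)), hq.smul_right x hx _ (hv a), ih]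

theorem quad_smul {x : H} (hx : x ∈ Q) (c : ℂ) :
    (q (c • x) (c • x)).re = ‖c‖ ^ 2 * (q x x).re := by
  have h1 : q (c • x) (c • x) = c * (starRingEnd ℂ c * q x x) := by
    rw [hq.smul_right _ (Q.smul_mem c hx) _ hx, ← hq.conj_symm, hq.smul_right x hx x hx, map_mul,
      hq.conj_symm]
  have h2 : c * (starRingEnd ℂ c * q x x) = ((‖c‖ ^ 2 : ℝ) : ℂ) * q x x := by
    rw [← mul_assoc, Complex.mul_conj, Complex.normSq_eq_norm_sq]
  rw [h1, h2, Complex.re_ofReal_mul]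

theorem quad_add_of_orthogonal {x y : H} (hx : x ∈ Q) (hy : y ∈ Q) (h : q x y = 0) :
    (q (x + y) (x + y)).re = (q x x).re + (q y y).re := by
  have hxy := Q.add_mem hx hy
  have h' : q y x = 0 := by rw [← hq.conj_symm, h, map_zero]
  rw [hq.add_right _ hxy x hx y hy, ← hq.conj_symm (x + y) x, ← hq.conj_symm (x + y) y,
    hq.add_right x hx x hx y hy, hq.add_right y hy x hx y hy, h, h']
  simp

section EigenFamily

variable {ι : Type*} {e : ι → H} {l : ι → ℝ} (he : IsEigenFamily Q q e l)
include he

/-- The eigenvalue relation turns orthogonality in H into orthogonality for the form; every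
diagonalization below rests on this. -/
theorem form_sum_eq_zero (s : Finset ι) (c : ι → ℂ) {x : H} (hx : x ∈ Q)
    (h : ∀ k ∈ s, inner ℂ x (e k) = 0) : q x (∑ k ∈ s, c k • e k) = 0 := by
  rw [hq.sum_right s hx he.mem]
  refine Finset.sum_eq_zero fun k hk => ?_
  rw [he.eig k x hx, h k hk]
  simp

theorem quad_sum (s : Finset ι) (c : ι → ℂ) :
    (q (∑ k ∈ s, c k • e k) (∑ k ∈ s, c k • e k)).re = ∑ k ∈ s, l k * ‖c k‖ ^ 2 := by
  classical
  induction s using Finset.induction_on with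
  | empty => simp [hq.zero_right Q.zero_mem]
  | insert a s ha ih =>
    rw [Finset.sum_insert ha, Finset.sum_insert ha, hq.quad_add_of_orthogonal
      (Q.smul_mem _ (he.mem a)) (he.sum_mem s c), ih, hq.quad_smul (he.mem a),
      he.quad_eigen, mul_comm]
    apply form_sum_eq_zero hq he s c (Q.smul_mem _ (he.mem a))
    intro k hk
    rw [inner_smul_left, he.orthonormal.2 (by rintro rfl; exact ha hk), mul_zero]

theorem quad_eq_quad_sub_add (s : Finset ι) {x : H} (hx : x ∈ Q) :
    (q x x).re = (q (x - ∑ k ∈ s, inner ℂ (e k) x • e k)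
      (x - ∑ k ∈ s, inner ℂ (e k) x • e k)).re + ∑ k ∈ s, l k * ‖inner ℂ (e k) x‖ ^ 2 := by
  set P := ∑ k ∈ s, inner ℂ (e k) x • e k with hP
  have hPQ : P ∈ Q := he.sum_mem s _
  have h : q (x - P) P = 0 := by
    apply form_sum_eq_zero hq he s _ (Q.sub_mem hx hPQ)
    intro k hk
    rw [inner_sub_left, hP, he.orthonormal.inner_left_sum _ hk, inner_conj_symm, sub_self]
  have := hq.quad_add_of_orthogonal (Q.sub_mem hx hPQ) hPQ h
  rw [sub_add_cancel] at this
  rw [this, hP, quad_sum hq he]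

theorem neg_le_eigenvalue (k : ι) : -b ≤ l k := by
  have := hq.lower_bound _ (he.mem k)
  rwa [he.orthonormal.1 k, he.quad_eigen, one_pow, mul_one] at this

/-- A Bessel inequality for the form: the projection remainder has form value at least −b‖x − P‖²,
and the shift by b makes all terms nonnegative. -/
theorem summable_mul_norm_inner_sq {x : H} (hx : x ∈ Q) :
    Summable fun k => l k * ‖inner ℂ (e k) x‖ ^ 2 := by
  have hb := he.orthonormal.inner_products_summable x
  have h1 : Summable fun k => (l k + b) * ‖inner ℂ (e k) x‖ ^ 2 := by
    refine summable_of_sum_le (c := (q x x).re + 5 * |b| * ‖x‖ ^ 2) (fun k => ?_) (fun s => ?_)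
    -- The 5 is 4 + 1: ‖x − P‖² ≤ 4‖x‖² for the remainder, and ‖x‖² for the shift.
    · have := neg_le_eigenvalue hq he k
      exact mul_nonneg (by linarith) (sq_nonneg _)
    · have h1 := quad_eq_quad_sub_add hq he s hx
      set P := ∑ k ∈ s, inner ℂ (e k) x • e k with hP
      have h2 := hq.lower_bound _ (Q.sub_mem hx (he.sum_mem s fun k => inner ℂ (e k) x))
      have h3 := he.orthonormal.sum_inner_products_le x (s := s)
      have h4 : ‖P‖ ≤ ‖x‖ := by
        have h5 : ‖P‖ ^ 2 ≤ ‖x‖ ^ 2 := (he.norm_sum_sq s _).trans_le h3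
        exact le_of_sq_le_sq h5 (norm_nonneg _)
      have h6 : ‖x - P‖ ^ 2 ≤ (‖x‖ + ‖x‖) ^ 2 := by
        gcongr
        exact (norm_sub_le _ _).trans (by linarith)
      simp_rw [add_mul, Finset.sum_add_distrib, ← Finset.mul_sum]
      have h7 : b * ∑ k ∈ s, ‖inner ℂ (e k) x‖ ^ 2 ≤ |b| * ‖x‖ ^ 2 :=
        (mul_le_mul_of_nonneg_right (le_abs_self b)
          (Finset.sum_nonneg fun _ _ => sq_nonneg _)).trans
          (mul_le_mul_of_nonneg_left h3 (abs_nonneg b))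
      have h8 : ‖x - P‖ ^ 2 * b ≤ (‖x‖ + ‖x‖) ^ 2 * |b| :=
        (mul_le_mul_of_nonneg_left (le_abs_self b) (sq_nonneg _)).trans
          (mul_le_mul_of_nonneg_right h6 (abs_nonneg b))
      nlinarith
  have h2 := h1.sub (hb.mul_left b)
  refine h2.congr fun k => ?_
  ring

end EigenFamily

/-- Fourier synthesis in the form domain. -/
theorem mem_and_hasSum_of_hasSum [CompleteSpace H] {e : ℕ → H} {l : ℕ → ℝ}
    (he : IsEigenFamily Q q e l) {c : ℕ → ℂ} {x : H} (hx : HasSum (fun k => c k • e k) x)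
    (hs : Summable fun k => l k * ‖c k‖ ^ 2) :
    x ∈ Q ∧ HasSum (fun k => l k * ‖c k‖ ^ 2) (q x x).re := by
  have hE := hs.hasSum.tendsto_sum_nat
  -- The form of a block of the series is the corresponding block of Σ l_k |c_k|², so partial sums
  -- are form-Cauchy. An upper bound suffices there, since semiboundedness controls the other side
  -- along a convergent sequence.
  obtain ⟨h1, h2⟩ := hq.closed (fun n => ∑ k ∈ Finset.range n, c k • e k) x
    (fun n => he.sum_mem _ _) hx.tendsto_sum_nat (fun ε hε => by
      obtain ⟨N, hN⟩ := Metric.cauchySeq_iff.1 hE.cauchySeq ε hε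
      refine ⟨N, fun n hn m hm => ?_⟩
      rw [← Finset.sum_Ico_eq_sub _ hm, hq.quad_sum he, Finset.sum_Ico_eq_sub _ hm]
      have := hN m (hn.trans hm) n hn
      rw [Real.dist_eq] at this
      exact (le_abs_self _).trans_lt this)
  refine ⟨h1, ?_⟩
  simp_rw [hq.quad_sum he] at h2
  rw [tendsto_nhds_unique h2 hE]
  exact hs.hasSum

/-! ### Min-max values, completeness of the eigenvectors, Ky Fan inequality -/

section MinMax

variable {e : ℕ → H} {l : ℕ → ℝ} (he : IsEigenFamily Q q e l)
  (hmin : ∀ i (F : Submodule ℂ H) (r : ℝ), F ≤ Q → Module.finrank ℂ F = i + 1 →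
    (∀ x ∈ F, ‖x‖ = 1 → (q x x).re ≤ r) → l i ≤ r)
include he hmin

/-- The span of x and of the e_j with j < i is an admissible test space of dimension i + 1. The form
is diagonal on it, with all diagonal entries at most r. -/
theorem eigenvalue_le {i : ℕ} {x : H} {r : ℝ} (hx : x ∈ Q) (hx1 : ‖x‖ = 1)
    (horth : ∀ j < i, inner ℂ x (e j) = 0) (hxr : (q x x).re ≤ r) (hr : ∀ j < i, l j ≤ r) :
    l i ≤ r := by
  have hf := he.comp_injective (Fin.val_injective (n := i))
  -- The index `none` carries x, which makes i + 1 vectors.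
  let v : Option (Fin i) → H := fun o => o.elim x (fun j => e j)
  have hv : Orthonormal ℂ v := by
    refine ⟨?_, ?_⟩
    · rintro (_ | j)
      · exact hx1
      · exact he.orthonormal.1 j
    · rintro (_ | j) (_ | k) hjk
      · exact absurd rfl hjk
      · exact horth k k.2
      · exact inner_eq_zero_symm.1 (horth j j.2)
      · exact hf.orthonormal.2 (fun h => hjk (by rw [h]))
  refine hmin i (Submodule.span ℂ (Set.range v)) r ?_ ?_ ?_
  · rw [Submodule.span_le]
    rintro _ ⟨_ | j, rfl⟩
    · exact hx
    · exact he.mem j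
  · rw [finrank_span_eq_card hv.linearIndependent]
    simp
  · intro y hy hy1
    obtain ⟨c, rfl⟩ := (Submodule.mem_span_range_iff_exists_fun ℂ).1 hy
    rw [Fintype.sum_option] at hy1 ⊢
    change ‖c none • x + ∑ j, c (some j) • (e ∘ Fin.val) j‖ = 1 at hy1
    change (q (c none • x + ∑ j, c (some j) • (e ∘ Fin.val) j)
      (c none • x + ∑ j, c (some j) • (e ∘ Fin.val) j)).re ≤ r
    have hxQ : c none • x ∈ Q := Q.smul_mem _ hx
    have ho : ∀ k ∈ (Finset.univ : Finset (Fin i)),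
        inner ℂ (c none • x) ((e ∘ Fin.val) k) = 0 := by
      intro k _
      rw [inner_smul_left, Function.comp, horth k k.2, mul_zero]
    rw [hq.quad_add_of_orthogonal hxQ (hf.sum_mem _ _)
      (hq.form_sum_eq_zero hf _ _ hxQ ho), hq.quad_smul hx, hq.quad_sum hf]
    have hn : ‖c none‖ ^ 2 + ∑ j, ‖c (some j)‖ ^ 2 = 1 := by
      rw [← hf.norm_sum_sq]
      have := norm_add_sq (𝕜 := ℂ) (c none • x) (∑ j, c (some j) • (e ∘ Fin.val) j)
      rw [hy1, inner_sum, Finset.sum_eq_zero (fun k hk => by rw [inner_smul_right, ho k hk, mul_zero]),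
        norm_smul, hx1] at this
      simp at this
      simpa using this.symm
    have h1 : ∑ j : Fin i, (l ∘ Fin.val) j * ‖c (some j)‖ ^ 2 ≤ ∑ j, r * ‖c (some j)‖ ^ 2 :=
      Finset.sum_le_sum fun j _ => mul_le_mul_of_nonneg_right (hr j j.2) (sq_nonneg _)
    rw [← Finset.mul_sum] at h1
    have h2 := mul_le_mul_of_nonneg_left hxr (sq_nonneg ‖c none‖)
    have h3 : ‖c none‖ ^ 2 * r + r * ∑ j, ‖c (some j)‖ ^ 2 = r := by
      rw [mul_comm, ← mul_add, hn, mul_one]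
    linarith

/-- Apply `eigenvalue_le` to x = e_k; strong induction supplies l_j ≤ l_k for j < i. -/
theorem eigenvalue_mono : Monotone l := by
  have h : ∀ i k, i ≤ k → l i ≤ l k := by
    intro i
    induction i using Nat.strong_induction_on with
    | _ i ih =>
      intro k hk
      exact hq.eigenvalue_le he hmin (he.mem k) (he.orthonormal.1 k)
        (fun j hj => he.orthonormal.2 (by omega)) (he.quad_eigen k).le
        (fun j hj => ih j hj k (by omega))
  exact fun i k => h i k

/-- After normalization, such an x is a test vector at every level, so its form value would bound
every l_i. This plays the role of compactness of the resolvent. -/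
theorem eq_zero_of_orthogonal (hl : ¬ BddAbove (range l)) {x : H} (hx : x ∈ Q)
    (horth : ∀ j, inner ℂ x (e j) = 0) : x = 0 := by
  by_contra hx0
  have hn : ‖x‖ ≠ 0 := norm_ne_zero_iff.2 hx0
  set y : H := ((‖x‖⁻¹ : ℝ) : ℂ) • x with hy
  have hyQ : y ∈ Q := Q.smul_mem _ hx
  have hy1 : ‖y‖ = 1 := by
    rw [hy, norm_smul, Complex.norm_real, norm_inv, norm_norm, inv_mul_cancel₀ hn]
  refine hl ⟨(q y y).re, ?_⟩
  rintro _ ⟨i, rfl⟩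
  induction i using Nat.strong_induction_on with
  | _ i ih =>
    exact hq.eigenvalue_le he hmin hyQ hy1
      (fun j _ => by rw [hy, inner_smul_left, horth, mul_zero]) le_rfl ih

variable [CompleteSpace H] (hl : ¬ BddAbove (range l))
include hl

/-- The Fourier series converges by Bessel to some y. Closedness puts y in Q, which is what allows
`eq_zero_of_orthogonal` to be applied to x − y. -/
theorem hasSum_of_mem {x : H} (hx : x ∈ Q) :
    HasSum (fun k => (inner ℂ (e k) x : ℂ) • e k) x := by
  have h1 := he.orthonormal.inner_products_summable x
  have h2 : Summable fun k => (inner ℂ (e k) x : ℂ) • e k := by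
    simpa using (he.orthonormal.orthogonalFamily.summable_iff_norm_sq_summable
      fun k => (inner ℂ (e k) x : ℂ)).2 h1
  obtain ⟨y, hy⟩ := h2
  obtain ⟨hyQ, -⟩ := hq.mem_and_hasSum_of_hasSum he hy (hq.summable_mul_norm_inner_sq he hx)
  have : x - y = 0 := by
    refine hq.eq_zero_of_orthogonal he hmin hl (Q.sub_mem hx hyQ) fun j => ?_
    have h3 : HasSum (fun k => inner ℂ (e j) ((inner ℂ (e k) x : ℂ) • e k)) (inner ℂ (e j) y) :=
      hy.mapL (innerSL ℂ (e j))
    have h4 := h3.unique (hasSum_single j fun k hk => by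
      rw [inner_smul_right, he.orthonormal.2 hk.symm, mul_zero])
    rw [inner_smul_right, inner_self_eq_norm_sq_to_K, he.orthonormal.1 j] at h4
    rw [inner_sub_left, ← inner_conj_symm, ← inner_conj_symm y, h4]
    simp
  rwa [← sub_eq_zero.1 this] at hy

theorem hasSum_quad {x : H} (hx : x ∈ Q) :
    HasSum (fun k => l k * ‖inner ℂ (e k) x‖ ^ 2) (q x x).re :=
  (hq.mem_and_hasSum_of_hasSum he (hq.hasSum_of_mem he hmin hl hx)
    (hq.summable_mul_norm_inner_sq he hx)).2

/-- A vector orthogonal to every e_k is orthogonal to Q by the expansion, and Q is dense. -/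
theorem span_orthogonal_eq_bot (hd : Dense (Q : Set H)) :
    (Submodule.span ℂ (Set.range e))ᗮ = ⊥ := by
  rw [Submodule.eq_bot_iff]
  intro z hz
  have hz' : ∀ k, inner ℂ z (e k) = 0 := fun k =>
    inner_eq_zero_symm.1 (hz (e k) (Submodule.subset_span ⟨k, rfl⟩))
  refine hd.eq_zero_of_inner_left ℂ fun x hx => ?_
  have h : HasSum (fun k => inner ℂ z ((inner ℂ (e k) x : ℂ) • e k)) (inner ℂ z x) :=
    (hq.hasSum_of_mem he hmin hl hx).mapL (innerSL ℂ z)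
  simp_rw [inner_smul_right, hz', mul_zero] at h
  exact h.unique hasSum_zero

/-- Fourier characterization of membership in the form domain and of the values of the form. -/
theorem mem_and_quad_eq (hd : Dense (Q : Set H)) {x y : H} (hx : x ∈ Q)
    (h : ∀ k, ‖inner ℂ (e k) y‖ = ‖inner ℂ (e k) x‖) : y ∈ Q ∧ (q y y).re = (q x x).re := by
  have hb := hq.span_orthogonal_eq_bot he hmin hl hd
  have hy := (HilbertBasis.mkOfOrthogonalEqBot he.orthonormal hb).hasSum_repr y
  simp only [HilbertBasis.repr_apply_apply, HilbertBasis.coe_mkOfOrthogonalEqBot] at hy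
  have hE := hq.hasSum_quad he hmin hl hx
  simp_rw [← h] at hE
  obtain ⟨h1, h2⟩ := hq.mem_and_hasSum_of_hasSum he hy hE.summable
  exact ⟨h1, h2.unique hE⟩

theorem hasSum_norm_inner_sq {x : H} (hx : x ∈ Q) :
    HasSum (fun k => ‖inner ℂ (e k) x‖ ^ 2) (‖x‖ ^ 2) := by
  have h : HasSum (fun k => inner ℂ x ((inner ℂ (e k) x : ℂ) • e k)) (inner ℂ x x) :=
    (hq.hasSum_of_mem he hmin hl hx).mapL (innerSL ℂ x)
  rw [inner_self_eq_norm_sq_to_K] at h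
  have h2 := h.mapL Complex.reCLM
  convert h2 using 1
  · funext k
    rw [Complex.reCLM_apply, inner_smul_right, ← inner_conj_symm x, Complex.mul_conj,
      Complex.normSq_eq_norm_sq, Complex.ofReal_re]
  · rw [Complex.reCLM_apply]
    exact_mod_cast rfl

/-- The Ky Fan inequality: the sum of the first `n` eigenvalues is the minimum of the sum of the
form over orthonormal families of length `n`. -/
theorem sum_eigenvalue_le (n : ℕ) {v : ℕ → H} (hv : Orthonormal ℂ v) (hvQ : ∀ i < n, v i ∈ Q) :
    ∑ i ∈ Finset.range n, l i ≤ ∑ i ∈ Finset.range n, (q (v i) (v i)).re := by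
  have hmono := hq.eigenvalue_mono he hmin
  have h1 : HasSum (fun k => ∑ i ∈ Finset.range n, l k * ‖inner ℂ (e k) (v i)‖ ^ 2)
      (∑ i ∈ Finset.range n, (q (v i) (v i)).re) :=
    hasSum_sum fun i hi => hq.hasSum_quad he hmin hl (hvQ i (Finset.mem_range.1 hi))
  have h2 : HasSum (fun k => ∑ i ∈ Finset.range n, ‖inner ℂ (e k) (v i)‖ ^ 2) (n : ℝ) := by
    have : HasSum (fun k => ∑ i ∈ Finset.range n, ‖inner ℂ (e k) (v i)‖ ^ 2)
        (∑ i ∈ Finset.range n, ‖v i‖ ^ 2) := hasSum_sum fun i hi =>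
      hq.hasSum_norm_inner_sq he hmin hl (hvQ i (Finset.mem_range.1 hi))
    simpa [hv.1] using this
  have h3 : HasSum (fun k => if k ∈ Finset.range n then l k - l n else 0)
      (∑ k ∈ Finset.range n, (l k - l n)) := by
    have := hasSum_sum_of_ne_finset_zero (s := Finset.range n) (L := SummationFilter.unconditional ℕ)
      (f := fun k => if k ∈ Finset.range n then l k - l n else 0) (fun k hk => if_neg hk)
    rwa [Finset.sum_congr rfl fun k hk => if_pos hk] at this
  -- The weight w_k = Σ_i |⟨e_k, v_i⟩|² lies in [0, 1] and has total mass n. Since l_k − l_n is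
  -- nonpositive for k < n and nonnegative otherwise, (l_k − l_n) w_k ≥ (l_k − l_n) 1_{k<n}; summing
  -- over k gives the claim.
  have h4 : ∀ k, (if k ∈ Finset.range n then l k - l n else 0) +
      l n * ∑ i ∈ Finset.range n, ‖inner ℂ (e k) (v i)‖ ^ 2 ≤
      ∑ i ∈ Finset.range n, l k * ‖inner ℂ (e k) (v i)‖ ^ 2 := by
    intro k
    rw [← Finset.mul_sum]
    set w := ∑ i ∈ Finset.range n, ‖inner ℂ (e k) (v i)‖ ^ 2
    have hw0 : 0 ≤ w := Finset.sum_nonneg fun _ _ => sq_nonneg _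
    have hw1 : w ≤ 1 := by
      have := hv.sum_inner_products_le (e k) (s := Finset.range n)
      rw [he.orthonormal.1 k, one_pow] at this
      simpa only [w, norm_inner_symm] using this
    split_ifs with hk
    · have := hmono (Finset.mem_range.1 hk).le
      nlinarith
    · have := hmono (not_lt.1 (mt Finset.mem_range.2 hk))
      nlinarith
  have h5 := hasSum_le h4 (h3.add (h2.mul_left (l n))) h1
  rw [Finset.sum_sub_distrib] at h5
  simp only [Finset.sum_const, Finset.card_range, nsmul_eq_mul] at h5
  linarith

end MinMax
end IsClosedForm

end AbstractForm
/-! ### Weak derivatives and multiplication operators on `L²` -/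

section Concrete

variable {d : ℕ}

theorem isWeakPartial_iff {k : Fin d} {ψ g : L2 d} : IsWeakPartial k ψ g ↔
    LineDeriv.lineDerivOpCLM ℂ 𝓢'(Space d, ℂ) (EuclideanSpace.single k (1 : ℝ) : Space d)
      (Lp.toTemperedDistributionCLM ℂ volume 2 ψ) = Lp.toTemperedDistributionCLM ℂ volume 2 g :=
  Iff.rfl

namespace IsWeakPartial

variable {k : Fin d} {ψ φ g f : L2 d}

theorem add (h : IsWeakPartial k ψ g) (h' : IsWeakPartial k φ f) :
    IsWeakPartial k (ψ + φ) (g + f) := by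
  rw [isWeakPartial_iff] at *
  rw [map_add, map_add, map_add, h, h']

theorem smul (c : ℂ) (h : IsWeakPartial k ψ g) : IsWeakPartial k (c • ψ) (c • g) := by
  rw [isWeakPartial_iff] at *
  rw [map_smul, map_smul, map_smul, h]

theorem unique (h : IsWeakPartial k ψ g) (h' : IsWeakPartial k ψ f) : g = f := by
  rw [isWeakPartial_iff] at *
  have h0 := Lp.ker_toTemperedDistributionCLM_eq_bot (F := ℂ) (μ := (volume : Measure (Space d)))
    (p := 2)
  exact LinearMap.ker_eq_bot.1 h0 (h.symm.trans h')

/-- The weak derivative is a closed operator: distributional differentiation and the embedding of L²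
are both continuous. -/
theorem of_tendsto {u v : ℕ → L2 d} (h : ∀ n, IsWeakPartial k (u n) (v n))
    (hu : Tendsto u atTop (𝓝 ψ)) (hv : Tendsto v atTop (𝓝 g)) : IsWeakPartial k ψ g := by
  simp_rw [isWeakPartial_iff] at *
  have h1 := ((LineDeriv.lineDerivOpCLM ℂ 𝓢'(Space d, ℂ)
    (EuclideanSpace.single k (1 : ℝ) : Space d)).continuous.comp
      (Lp.toTemperedDistributionCLM ℂ volume 2).continuous).tendsto ψ |>.comp hu
  have h2 := (Lp.toTemperedDistributionCLM ℂ volume 2).continuous.tendsto g |>.comp hv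
  refine tendsto_nhds_unique h1 (h2.congr fun n => (h n).symm)

theorem weakPartial_eq (h : IsWeakPartial k ψ g) : weakPartial k ψ = g := by
  have h' : ∃ g, IsWeakPartial k ψ g := ⟨g, h⟩
  rw [weakPartial, dif_pos h']
  exact h'.choose_spec.unique h

end IsWeakPartial

theorem MemH1.isWeakPartial {ψ : L2 d} (h : MemH1 ψ) (k : Fin d) :
    IsWeakPartial k ψ (weakPartial k ψ) := by
  obtain ⟨g, hg⟩ := h k
  rwa [hg.weakPartial_eq]

theorem weakPartial_add {ψ φ : L2 d} (hψ : MemH1 ψ) (hφ : MemH1 φ) (k : Fin d) :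
    weakPartial k (ψ + φ) = weakPartial k ψ + weakPartial k φ :=
  ((hψ.isWeakPartial k).add (hφ.isWeakPartial k)).weakPartial_eq

theorem weakPartial_smul {ψ : L2 d} (hψ : MemH1 ψ) (c : ℂ) (k : Fin d) :
    weakPartial k (c • ψ) = c • weakPartial k ψ :=
  ((hψ.isWeakPartial k).smul c).weakPartial_eq

open Classical in
/-- Multiplication by the real function `w` on `L²` (with value `0` off its domain). -/
noncomputable def mulOp (w : Space d → ℝ) (ψ : L2 d) : L2 d :=
  if h : MemLp (fun x => (w x : ℂ) * ψ x) 2 volume then h.toLp _ else 0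

/-- The domain of the operator of multiplication by `w`. -/
def MemMul (w : Space d → ℝ) (ψ : L2 d) : Prop := MemLp (fun x => (w x : ℂ) * ψ x) 2 volume

variable {w : Space d → ℝ} {ψ φ : L2 d}

theorem MemMul.coeFn_mulOp (h : MemMul w ψ) : mulOp w ψ =ᵐ[volume] fun x => (w x : ℂ) * ψ x := by
  rw [mulOp, dif_pos (show MemLp (fun x => (w x : ℂ) * ψ x) 2 volume from h)]
  exact MemLp.coeFn_toLp h

theorem memMul_of_ae_eq {g : L2 d} (h : g =ᵐ[volume] fun x => (w x : ℂ) * ψ x) : MemMul w ψ :=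
  (Lp.memLp g).ae_eq h

theorem mulOp_eq {g : L2 d} (h : g =ᵐ[volume] fun x => (w x : ℂ) * ψ x) : mulOp w ψ = g :=
  Lp.ext ((memMul_of_ae_eq h).coeFn_mulOp.trans h.symm)

theorem MemMul.add_ae (hψ : MemMul w ψ) (hφ : MemMul w φ) :
    (mulOp w ψ + mulOp w φ : L2 d) =ᵐ[volume] fun x => (w x : ℂ) * (ψ + φ : L2 d) x := by
  filter_upwards [Lp.coeFn_add (mulOp w ψ) (mulOp w φ), Lp.coeFn_add ψ φ, hψ.coeFn_mulOp,
    hφ.coeFn_mulOp] with x h1 h2 h3 h4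
  rw [h1, h2, Pi.add_apply, Pi.add_apply, h3, h4, mul_add]

theorem MemMul.smul_ae (hψ : MemMul w ψ) (c : ℂ) :
    (c • mulOp w ψ : L2 d) =ᵐ[volume] fun x => (w x : ℂ) * (c • ψ : L2 d) x := by
  filter_upwards [Lp.coeFn_smul c (mulOp w ψ), Lp.coeFn_smul c ψ, hψ.coeFn_mulOp] with x h1 h2 h3
  rw [h1, h2, Pi.smul_apply, Pi.smul_apply, h3, smul_eq_mul, smul_eq_mul, mul_left_comm]

/-- Multiplication is a closed operator: along a common subsequence both limits hold almost
everywhere and can be compared pointwise. -/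
theorem ae_eq_mul_of_tendsto {u : ℕ → L2 d} {g : L2 d} (h : ∀ n, MemMul w (u n))
    (hu : Tendsto u atTop (𝓝 ψ)) (hv : Tendsto (fun n => mulOp w (u n)) atTop (𝓝 g)) :
    g =ᵐ[volume] fun x => (w x : ℂ) * ψ x := by
  obtain ⟨ns, hns, h1⟩ := (tendstoInMeasure_of_tendsto_Lp hu).exists_seq_tendsto_ae
  obtain ⟨ms, hms, h2⟩ := (tendstoInMeasure_of_tendsto_Lp
    (hv.comp hns.tendsto_atTop)).exists_seq_tendsto_ae
  filter_upwards [h1, h2, ae_all_iff.2 fun n => (h n).coeFn_mulOp] with x h1 h2 h3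
  refine tendsto_nhds_unique h2 ?_
  simp only [Function.comp_apply, h3]
  exact (h1.comp hms.tendsto_atTop).const_mul _

/-! ### The form of `-Δ + V` is closed, semibounded and densely defined -/

/-- The square root `√|V|` of the modulus of the potential. -/
noncomputable def potentialRoot (V : Space d → ℝ) (x : Space d) : ℝ := √|V x|

/-- The signed square root `V / √|V|` of the potential (`0` where `V` vanishes). -/
noncomputable def signedRoot (V : Space d → ℝ) (x : Space d) : ℝ := V x / √|V x|

variable {V : Space d → ℝ}

/-- This factorization writes the potential part of the form as an inner product of two L²
functions, although V changes sign; both factors have modulus √|V|, hence the same domain. -/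
theorem potentialRoot_mul_signedRoot (x : Space d) : potentialRoot V x * signedRoot V x = V x := by
  rw [potentialRoot, signedRoot]
  by_cases h : V x = 0
  · simp [h]
  · have : √|V x| ≠ 0 := (Real.sqrt_pos.2 (abs_pos.2 h)).ne'
    field_simp

theorem abs_potentialRoot (x : Space d) : |potentialRoot V x| = √|V x| :=
  abs_of_nonneg (Real.sqrt_nonneg _)

theorem abs_signedRoot (x : Space d) : |signedRoot V x| = √|V x| := by
  rw [signedRoot, abs_div, abs_of_nonneg (Real.sqrt_nonneg |V x|), Real.div_sqrt]

theorem memMul_iff_integrable (hV : AEStronglyMeasurable V volume)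
    (hw : AEStronglyMeasurable w volume) (hwV : ∀ x, |w x| = √|V x|) :
    MemMul w ψ ↔ Integrable (fun x => V x * ‖ψ x‖ ^ 2) volume := by
  have hψ := Lp.aestronglyMeasurable ψ
  have hm : AEStronglyMeasurable (fun x => (w x : ℂ) * ψ x) volume :=
    (Complex.continuous_ofReal.comp_aestronglyMeasurable hw).mul hψ
  have hm' : AEStronglyMeasurable (fun x => V x * ‖ψ x‖ ^ 2) volume := hV.mul (hψ.norm.pow 2)
  rw [MemMul, memLp_two_iff_integrable_sq_norm hm, ← integrable_norm_iff hm']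
  refine integrable_congr (ae_of_all _ fun x => ?_)
  simp only [norm_mul, Complex.norm_real, Real.norm_eq_abs, hwV, mul_pow, Real.sq_sqrt (abs_nonneg _)]
  simp

section Admissible

variable (hV : IsAdmissiblePotential V)
include hV

theorem IsAdmissiblePotential.aestronglyMeasurable : AEStronglyMeasurable V volume :=
  hV.locallyIntegrable.aestronglyMeasurable

theorem aestronglyMeasurable_potentialRoot : AEStronglyMeasurable (potentialRoot V) volume :=
  Real.continuous_sqrt.comp_aestronglyMeasurable
    (continuous_abs.comp_aestronglyMeasurable hV.aestronglyMeasurable)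

theorem aestronglyMeasurable_signedRoot : AEStronglyMeasurable (signedRoot V) volume :=
  (hV.aestronglyMeasurable.aemeasurable.div
    (aestronglyMeasurable_potentialRoot hV).aemeasurable).aestronglyMeasurable

theorem mem_formDomain_iff : ψ ∈ formDomain V ↔ MemH1 ψ ∧ MemMul (potentialRoot V) ψ :=
  and_congr_right fun _ => (memMul_iff_integrable hV.aestronglyMeasurable
    (aestronglyMeasurable_potentialRoot hV) abs_potentialRoot).symm

theorem memMul_signedRoot (h : ψ ∈ formDomain V) : MemMul (signedRoot V) ψ :=
  (memMul_iff_integrable hV.aestronglyMeasurable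
    (aestronglyMeasurable_signedRoot hV) abs_signedRoot).2 h.2

theorem memMul_potentialRoot (h : ψ ∈ formDomain V) : MemMul (potentialRoot V) ψ :=
  ((mem_formDomain_iff hV).1 h).2

/-- The form domain as a subspace of `L²`. -/
def formSubmodule : Submodule ℂ (L2 d) where
  carrier := formDomain V
  zero_mem' := by
    rw [mem_formDomain_iff hV]
    refine ⟨fun k => ⟨0, ?_⟩, ?_⟩
    · rw [isWeakPartial_iff, map_zero, map_zero]
    · refine memMul_of_ae_eq (g := 0) ?_
      filter_upwards with x
      simp
  add_mem' := by
    intro a b ha hb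
    rw [mem_formDomain_iff hV] at *
    exact ⟨fun k => ⟨_, (ha.1.isWeakPartial k).add (hb.1.isWeakPartial k)⟩,
      memMul_of_ae_eq (ha.2.add_ae hb.2)⟩
  smul_mem' := by
    intro c a ha
    rw [mem_formDomain_iff hV] at *
    exact ⟨fun k => ⟨_, (ha.1.isWeakPartial k).smul c⟩, memMul_of_ae_eq (ha.2.smul_ae c)⟩

theorem energyForm_eq (hφ : φ ∈ formDomain V) (hψ : ψ ∈ formDomain V) :
    energyForm V φ ψ = ∑ k, inner ℂ (weakPartial k φ) (weakPartial k ψ) +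
      inner ℂ (mulOp (potentialRoot V) φ) (mulOp (signedRoot V) ψ) := by
  rw [energyForm, L2.inner_def]
  congr 1
  refine integral_congr_ae ?_
  filter_upwards [(memMul_potentialRoot hV hφ).coeFn_mulOp,
    (memMul_signedRoot hV hψ).coeFn_mulOp] with x h1 h2
  rw [h1, h2, RCLike.inner_apply, map_mul, Complex.conj_ofReal,
    ← potentialRoot_mul_signedRoot (V := V) x]
  push_cast
  ring

omit hV in
theorem energyForm_conj (φ ψ : L2 d) :
    starRingEnd ℂ (energyForm V ψ φ) = energyForm V φ ψ := by
  rw [energyForm, energyForm, map_add, map_sum, ← integral_conj]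
  congr 1
  · exact Finset.sum_congr rfl fun k _ => inner_conj_symm _ _
  · refine integral_congr_ae (ae_of_all _ fun x => ?_)
    simp only [map_mul, Complex.conj_ofReal, Complex.conj_conj]
    ring

omit hV in
theorem re_energyForm_self (ψ : L2 d) :
    (energyForm V ψ ψ).re = ∑ k, ‖weakPartial k ψ‖ ^ 2 + ∫ x, V x * ‖ψ x‖ ^ 2 := by
  rw [energyForm, Complex.add_re, Complex.re_sum]
  congr 1
  · refine Finset.sum_congr rfl fun k _ => ?_
    rw [inner_self_eq_norm_sq_to_K]
    exact_mod_cast rfl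
  · have : ∀ x, (V x : ℂ) * (starRingEnd ℂ (ψ x) * ψ x) = ((V x * ‖ψ x‖ ^ 2 : ℝ) : ℂ) := by
      intro x
      rw [mul_comm (starRingEnd ℂ _), Complex.mul_conj, Complex.normSq_eq_norm_sq]
      push_cast; rfl
    simp_rw [this]
    rw [integral_complex_ofReal, Complex.ofReal_re]

omit hV in
theorem energy_of_mem (h : ψ ∈ formDomain V) : energy V ψ = ((energyForm V ψ ψ).re : ℝ) := by
  rw [energy, if_pos h, re_energyForm_self]

omit hV in
theorem norm_mulOp_sq (h : MemMul w ψ) (hwV : ∀ x, |w x| = √|V x|) :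
    ‖mulOp w ψ‖ ^ 2 = ∫ x, |V x| * ‖ψ x‖ ^ 2 := by
  have h0 := inner_self_eq_norm_sq_to_K (𝕜 := ℂ) (mulOp w ψ)
  rw [L2.inner_def] at h0
  rw [← Complex.ofReal_inj, Complex.ofReal_pow]
  refine h0.symm.trans ?_
  rw [← integral_complex_ofReal]
  refine integral_congr_ae ?_
  filter_upwards [h.coeFn_mulOp] with x hx
  rw [hx, inner_self_eq_norm_sq_to_K, norm_mul, Complex.norm_real, Real.norm_eq_abs, hwV]
  simp only [Complex.coe_algebraMap, ← Complex.ofReal_pow, Complex.ofReal_inj]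
  rw [mul_pow, Real.sq_sqrt (abs_nonneg _)]

/-- The form controls the norm of `H¹` and of `√|V| ψ`. -/
theorem exists_coercive : ∃ C b : ℝ, 0 < C ∧ 0 ≤ b ∧ ∀ ψ ∈ formDomain V,
    ∑ k, ‖weakPartial k ψ‖ ^ 2 + ∫ x, |V x| * ‖ψ x‖ ^ 2 ≤
      C * ((energyForm V ψ ψ).re + b * ‖ψ‖ ^ 2) := by
  obtain ⟨a, b, ha, hab⟩ := hV.negPart_formBounded
  have ha' : (0 : ℝ) < 1 - a := sub_pos.2 (by exact_mod_cast ha)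
  -- Write T, P, M, N for Σ‖∂_kψ‖², ∫|V||ψ|², ∫V₋|ψ|², ‖ψ‖². The form is T + P − 2M, and with these
  -- constants the right side minus the left, times 1 − a, is 2(aT + bN − M) + 2a(P − M) + 2abN, a
  -- sum of nonnegative terms.
  refine ⟨(1 + a) / (1 - a), 2 * b, by positivity, by positivity, fun ψ hψ => ?_⟩
  have hi : Integrable (fun x => |V x| * ‖ψ x‖ ^ 2) volume := by
    refine hψ.2.norm.congr (ae_of_all _ fun x => ?_)
    simp
  set T := ∑ k, ‖weakPartial k ψ‖ ^ 2
  have hT : 0 ≤ T := Finset.sum_nonneg fun _ _ => sq_nonneg _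
  have hm_int : Integrable (fun x => max (-V x) 0 * ‖ψ x‖ ^ 2) volume := by
    refine ((hi.sub hψ.2).div_const 2).congr (ae_of_all _ fun x => ?_)
    simp only [Pi.sub_apply]
    rcases le_total 0 (V x) with h | h
    · rw [abs_of_nonneg h, max_eq_right (by linarith)]; ring
    · rw [abs_of_nonpos h, max_eq_left (by linarith)]; ring
  have hm : ∫ x, max (-V x) 0 * ‖ψ x‖ ^ 2 ≤ a * T + b * ‖ψ‖ ^ 2 := by
    have h1 := hab ψ hψ.1
    have h2 : ∫⁻ x, ENNReal.ofReal (-V x) * ‖ψ x‖ₑ ^ 2 =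
        ENNReal.ofReal (∫ x, max (-V x) 0 * ‖ψ x‖ ^ 2) := by
      rw [ofReal_integral_eq_lintegral_ofReal hm_int
        (ae_of_all _ fun x => mul_nonneg (le_max_right _ _) (sq_nonneg _))]
      refine lintegral_congr fun x => ?_
      rw [ENNReal.ofReal_mul (le_max_right _ _), ENNReal.ofReal_pow (norm_nonneg _), ofReal_norm]
      congr 1
      rcases le_total 0 (-V x) with h | h
      · rw [max_eq_left h]
      · rw [max_eq_right h, ENNReal.ofReal_of_nonpos h, ENNReal.ofReal_zero]
    have h3 : (a : ℝ≥0∞) * ∑ k, ‖weakPartial k ψ‖ₑ ^ 2 + (b : ℝ≥0∞) * ‖ψ‖ₑ ^ 2 =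
        ENNReal.ofReal (a * T + b * ‖ψ‖ ^ 2) := by
      rw [ENNReal.ofReal_add (by positivity) (by positivity), ENNReal.ofReal_mul (by positivity),
        ENNReal.ofReal_mul (by positivity), ENNReal.ofReal_sum_of_nonneg fun _ _ => sq_nonneg _,
        ENNReal.ofReal_coe_nnreal, ENNReal.ofReal_coe_nnreal, ENNReal.ofReal_pow (norm_nonneg _),
        ofReal_norm]
      simp_rw [ENNReal.ofReal_pow (norm_nonneg _), ofReal_norm]
    rw [h2, h3] at h1
    exact (ENNReal.ofReal_le_ofReal_iff (by positivity)).1 h1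
  have hm0 : 0 ≤ ∫ x, max (-V x) 0 * ‖ψ x‖ ^ 2 :=
    integral_nonneg fun x => mul_nonneg (le_max_right _ _) (sq_nonneg _)
  have hsplit : ∫ x, V x * ‖ψ x‖ ^ 2 =
      (∫ x, |V x| * ‖ψ x‖ ^ 2) - 2 * ∫ x, max (-V x) 0 * ‖ψ x‖ ^ 2 := by
    rw [← integral_const_mul, ← integral_sub hi (hm_int.const_mul 2)]
    refine integral_congr_ae (ae_of_all _ fun x => ?_)
    simp only
    rcases le_total 0 (V x) with h | h
    · rw [abs_of_nonneg h, max_eq_right (by linarith)]; ring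
    · rw [abs_of_nonpos h, max_eq_left (by linarith)]; ring
  have hle : ∫ x, max (-V x) 0 * ‖ψ x‖ ^ 2 ≤ ∫ x, |V x| * ‖ψ x‖ ^ 2 :=
    integral_mono hm_int hi fun x =>
      mul_le_mul_of_nonneg_right (max_le (neg_le_abs _) (abs_nonneg _)) (sq_nonneg _)
  rw [re_energyForm_self, hsplit, div_mul_eq_mul_div, le_div_iff₀ ha']
  change (T + _) * _ ≤ _ * (T + _ + _)
  set P := ∫ x, |V x| * ‖ψ x‖ ^ 2
  set M := ∫ x, max (-V x) 0 * ‖ψ x‖ ^ 2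
  have ha0 : (0 : ℝ) ≤ a := a.2
  have h5 := mul_nonneg ha0 (sub_nonneg.2 hle)
  have h6 : (0 : ℝ) ≤ b * ‖ψ‖ ^ 2 := by positivity
  have h7 := mul_nonneg ha0 h6
  nlinarith

/-- Here A stands for one component of the form norm, a weak derivative or a multiplication by a
root of V; coercivity makes it Cauchy along form-Cauchy sequences. -/
theorem cauchySeq_of_form {C b : ℝ} (hC : 0 < C) (hb : 0 ≤ b) {A : L2 d → L2 d}
    (hA : ∀ x ∈ formSubmodule hV, ∀ y ∈ formSubmodule hV, A (x - y) = A x - A y)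
    (hAC : ∀ x ∈ formSubmodule hV, ‖A x‖ ^ 2 ≤ C * ((energyForm V x x).re + b * ‖x‖ ^ 2))
    {u : ℕ → L2 d} (hu : ∀ n, u n ∈ formSubmodule hV) (hc : CauchySeq u)
    (hE : ∀ ε > 0, ∃ N, ∀ n ≥ N, ∀ m ≥ n, (energyForm V (u m - u n) (u m - u n)).re < ε) :
    CauchySeq fun n => A (u n) := by
  rw [Metric.cauchySeq_iff']
  intro ε hε
  set δ := ε ^ 2 / (C * (1 + b)) with hδ
  have hδ0 : 0 < δ := by positivity
  obtain ⟨N, hN⟩ := hE δ hδ0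
  obtain ⟨M, hM⟩ := Metric.cauchySeq_iff.1 hc (√δ) (Real.sqrt_pos.2 hδ0)
  refine ⟨max N M, fun n hn => ?_⟩
  have h1 := hN (max N M) (le_max_left _ _) n hn
  have h2 := hM n ((le_max_right _ _).trans hn) (max N M) (le_max_right _ _)
  rw [dist_eq_norm] at h2 ⊢
  have h3 : ‖u n - u (max N M)‖ ^ 2 ≤ δ := by
    rw [← Real.sq_sqrt hδ0.le]
    gcongr
  rw [← hA _ (hu _) _ (hu _)]
  have h4 := hAC _ (Submodule.sub_mem _ (hu n) (hu (max N M)))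
  refine lt_of_pow_lt_pow_left₀ 2 hε.le (h4.trans_lt ?_)
  calc C * ((energyForm V (u n - u (max N M)) (u n - u (max N M))).re +
        b * ‖u n - u (max N M)‖ ^ 2) < C * (δ + b * δ) := by
        have := mul_le_mul_of_nonneg_left h3 hb
        exact mul_lt_mul_of_pos_left (by linarith) hC
    _ = ε ^ 2 := by rw [hδ]; field_simp

theorem weakPartial_sub_of_mem (k : Fin d) : ∀ x ∈ formSubmodule hV, ∀ y ∈ formSubmodule hV,
    weakPartial k (x - y) = weakPartial k x - weakPartial k y := by
  intro x hx y hy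
  rw [sub_eq_add_neg, ← neg_one_smul ℂ y, weakPartial_add hx.1 ((formSubmodule hV).smul_mem _ hy).1,
    weakPartial_smul hy.1, neg_one_smul, sub_eq_add_neg]

omit hV in
theorem MemMul.mulOp_sub (hψ : MemMul w ψ) (hφ : MemMul w φ) :
    mulOp w (ψ - φ) = mulOp w ψ - mulOp w φ := by
  have h1 := hφ.smul_ae (-1)
  rw [sub_eq_add_neg, ← neg_one_smul ℂ φ, mulOp_eq (hψ.add_ae (memMul_of_ae_eq h1)), mulOp_eq h1,
    neg_one_smul, sub_eq_add_neg]

/-- For closedness, all components converge in L² by coercivity, their limits are identified because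
each operator is closed, and the form is a continuous function of the components. -/
theorem exists_isClosedForm : ∃ b, IsClosedForm (formSubmodule hV) (energyForm V) b := by
  obtain ⟨C, b, hC, hb, hcoer⟩ := exists_coercive hV
  have hP0 : ∀ ψ : L2 d, 0 ≤ ∫ x, |V x| * ‖ψ x‖ ^ 2 := fun ψ =>
    integral_nonneg fun x => mul_nonneg (abs_nonneg _) (sq_nonneg _)
  have hT0 : ∀ ψ : L2 d, 0 ≤ ∑ k, ‖weakPartial k ψ‖ ^ 2 := fun ψ =>
    Finset.sum_nonneg fun _ _ => sq_nonneg _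
  refine ⟨b, energyForm_conj, ?_, ?_, ?_, ?_⟩
  · intro x hx y hy z hz
    rw [energyForm_eq hV hx ((formSubmodule hV).add_mem hy hz), energyForm_eq hV hx hy,
      energyForm_eq hV hx hz,
      mulOp_eq ((memMul_signedRoot hV hy).add_ae (memMul_signedRoot hV hz)), inner_add_right]
    simp_rw [weakPartial_add hy.1 hz.1, inner_add_right, Finset.sum_add_distrib]
    ring
  · intro x hx y hy c
    rw [energyForm_eq hV hx ((formSubmodule hV).smul_mem c hy), energyForm_eq hV hx hy,
      mulOp_eq ((memMul_signedRoot hV hy).smul_ae c), inner_smul_right, mul_add, Finset.mul_sum]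
    simp_rw [weakPartial_smul hy.1, inner_smul_right]
  · intro x hx
    have h1 := hcoer x hx
    have h2 : 0 ≤ C * ((energyForm V x x).re + b * ‖x‖ ^ 2) :=
      (add_nonneg (hT0 x) (hP0 x)).trans h1
    have h3 := (mul_nonneg_iff_of_pos_left hC).1 h2
    linarith
  · intro u x hu hx hE
    have hc : ∀ A : L2 d → L2 d, _ → _ → CauchySeq fun n => A (u n) := fun A h1 h2 =>
      cauchySeq_of_form hV hC hb h1 h2 hu hx.cauchySeq hE
    have hg : ∀ k, ∃ g, Tendsto (fun n => weakPartial k (u n)) atTop (𝓝 g) := fun k =>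
      cauchySeq_tendsto_of_complete (hc _ (weakPartial_sub_of_mem hV k) fun y hy => by
        have h1 := Finset.single_le_sum (f := fun k => ‖weakPartial k y‖ ^ 2)
          (fun _ _ => sq_nonneg _) (Finset.mem_univ k)
        have h2 := hcoer y hy
        have h3 := hP0 y
        linarith)
    have hmul : ∀ w : Space d → ℝ, (∀ x, |w x| = √|V x|) →
        (∀ y ∈ formSubmodule hV, MemMul w y) →
        ∃ g, Tendsto (fun n => mulOp w (u n)) atTop (𝓝 g) := fun w h1 h2 =>
      cauchySeq_tendsto_of_complete (hc _ (fun y hy z hz => (h2 y hy).mulOp_sub (h2 z hz))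
        fun y hy => by
          rw [norm_mulOp_sq (h2 y hy) h1]
          have h2 := hcoer y hy
          have h3 := hT0 y
          linarith)
    choose g hg using hg
    obtain ⟨g1, hg1⟩ := hmul _ abs_potentialRoot fun y hy => memMul_potentialRoot hV hy
    obtain ⟨g2, hg2⟩ := hmul _ abs_signedRoot fun y hy => memMul_signedRoot hV hy
    have hw : ∀ k, IsWeakPartial k x (g k) := fun k =>
      IsWeakPartial.of_tendsto (fun n => (hu n).1.isWeakPartial k) hx (hg k)
    have hm1 := ae_eq_mul_of_tendsto (fun n => memMul_potentialRoot hV (hu n)) hx hg1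
    have hm2 := ae_eq_mul_of_tendsto (fun n => memMul_signedRoot hV (hu n)) hx hg2
    have hxQ : x ∈ formDomain V :=
      (mem_formDomain_iff hV).2 ⟨fun k => ⟨g k, hw k⟩, memMul_of_ae_eq hm1⟩
    refine ⟨hxQ, ?_⟩
    rw [energyForm_eq hV hxQ hxQ, mulOp_eq hm1, mulOp_eq hm2]
    simp_rw [fun k => (hw k).weakPartial_eq, fun n => energyForm_eq hV (hu n) (hu n)]
    exact (Complex.continuous_re.tendsto _).comp
      ((tendsto_finsetSum _ fun k _ => (hg k).inner (hg k)).add (hg1.inner hg2))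

/-- Smooth compactly supported functions lie in the form domain, since V is locally integrable. -/
theorem dense_formSubmodule : Dense (formSubmodule hV : Set (L2 d)) := by
  refine (Lp.dense_hasCompactSupport_contDiff (F := ℂ) (E := Space d) (μ := volume)
    (p := 2) (by norm_num)).mono ?_
  rintro f ⟨g, hfg, hg, hg'⟩
  set G := hg.toSchwartzMap hg' with hG
  have hfG : f = G.toLp 2 volume := by
    refine Lp.ext (hfg.trans ?_)
    filter_upwards [G.coeFn_toLp 2 volume] with x hx
    rw [hx]; rfl
  refine ⟨fun k => ⟨(∂_{(EuclideanSpace.single k (1 : ℝ) : Space d)} G).toLp 2 volume, ?_⟩, ?_⟩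
  · rw [IsWeakPartial, hfG, Lp.toTemperedDistribution_toLp_eq, Lp.toTemperedDistribution_toLp_eq,
      TemperedDistribution.lineDerivOp_toTemperedDistributionCLM_eq]
  · have hc : HasCompactSupport fun x => ‖g x‖ ^ 2 :=
      hg.comp_left (g := fun z : ℂ => ‖z‖ ^ 2) (by simp)
    refine (hV.locallyIntegrable.integrable_smul_right_of_hasCompactSupport
      (hg'.continuous.norm.pow 2) hc).congr ?_
    filter_upwards [hfg] with x hx
    rw [hx, smul_eq_mul, Pi.pow_apply]

end Admissible
end Concrete
/-! ### Eigenvalues of `-Δ + V` and conservation of energy -/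

section Spectral

variable {d : ℕ} {V : Space d → ℝ} (hV : IsAdmissiblePotential V)
include hV

theorem IsEigenSequence.isEigenFamily {ψbar : ℕ → L2 d} (hE : IsEigenSequence V ψbar) :
    IsEigenFamily (formSubmodule hV) (energyForm V) ψbar (eigenvalue V) :=
  ⟨hE.orthonormal, fun k => (hE.eigenfunction k).1, fun k x hx => by
    rw [(hE.eigenfunction k).2 x hx, inner_smul_right]⟩

/-- This excludes the value −∞, at which `EReal.toReal` would return 0 and comparison with real
bounds would fail. -/
theorem exists_le_minMax : ∃ b : ℝ, ∀ i, (b : EReal) ≤ minMax V i := by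
  obtain ⟨b, hb⟩ := exists_isClosedForm hV
  refine ⟨-b, fun i => le_iInf₂ fun F hF => ?_⟩
  have : Nontrivial F := Module.nontrivial_of_finrank_pos (R := ℂ) (by omega)
  obtain ⟨⟨x, hx⟩, hx1⟩ := exists_norm_eq F (zero_le_one (α := ℝ))
  refine le_trans ?_ (le_iSup₂_of_le x hx (le_iSup_of_le hx1 le_rfl))
  by_cases hxQ : x ∈ formDomain V
  · rw [energy_of_mem hxQ, EReal.coe_le_coe_iff]
    have h1 := hb.lower_bound x hxQ
    have h2 : ‖x‖ = 1 := hx1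
    rwa [h2, one_pow, mul_one] at h1
  · rw [energy, if_neg hxQ]
    exact le_top

theorem eigenvalue_le_of_forall_le (i : ℕ) (F : Submodule ℂ (L2 d)) (r : ℝ)
    (hF : F ≤ formSubmodule hV) (hi : Module.finrank ℂ F = i + 1)
    (h : ∀ x ∈ F, ‖x‖ = 1 → (energyForm V x x).re ≤ r) : eigenvalue V i ≤ r := by
  obtain ⟨b, hb⟩ := exists_le_minMax hV
  have h1 : minMax V i ≤ (r : EReal) := by
    refine (iInf₂_le F hi).trans (iSup₂_le fun x hx => iSup_le fun hx1 => ?_)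
    rw [energy_of_mem (hF hx), EReal.coe_le_coe_iff]
    exact h x hx hx1
  have h2 := EReal.toReal_le_toReal h1
    (ne_bot_of_le_ne_bot (EReal.coe_ne_bot b) (hb i)) (EReal.coe_ne_top r)
  rwa [EReal.toReal_coe] at h2

variable {ψbar : ℕ → L2 d} (hE : IsEigenSequence V ψbar)
include hE

theorem energy_eigenfunction (i : ℕ) : energy V (ψbar i) = (eigenvalue V i : ℝ) := by
  have he := hE.isEigenFamily hV
  rw [energy_of_mem (he.mem i), he.quad_eigen]

theorem eigenvalue_monotone : Monotone (eigenvalue V) := by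
  obtain ⟨b, hb⟩ := exists_isClosedForm hV
  exact hb.eigenvalue_mono (hE.isEigenFamily hV) (eigenvalue_le_of_forall_le hV)

theorem sum_eigenvalue_le_sum_energy (n : ℕ) {v : ℕ → L2 d} (hv : Orthonormal ℂ v)
    (h : ∀ i < n, energy V (v i) ≠ ⊤) :
    ∑ i ∈ Finset.range n, eigenvalue V i ≤ ∑ i ∈ Finset.range n, (energy V (v i)).toReal := by
  obtain ⟨b, hb⟩ := exists_isClosedForm hV
  have h' : ∀ i < n, v i ∈ formDomain V := by
    intro i hi
    by_contra hc
    exact h i hi (if_neg hc)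
  refine (hb.sum_eigenvalue_le (hE.isEigenFamily hV) (eigenvalue_le_of_forall_le hV)
    hE.unbounded n hv h').trans (le_of_eq (Finset.sum_congr rfl fun i hi => ?_))
  rw [energy_of_mem (h' i (Finset.mem_range.1 hi)), EReal.toReal_coe]

omit hV in
/-- The weak Schrödinger equation preserves the modulus of each coefficient in the eigenbasis. -/
theorem norm_inner_eigenfunction_eq {ψ0 : L2 d} {ψ : ℝ → L2 d}
    (hψ : IsSchrodingerSolution V ψ0 ψ) (k : ℕ) {t : ℝ} (ht : 0 < t) :
    ‖(inner ℂ (ψbar k) (ψ t) : ℂ)‖ = ‖(inner ℂ (ψbar k) ψ0 : ℂ)‖ := by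
  have hcont : ContinuousOn (fun s => ‖(inner ℂ (ψbar k) (ψ s) : ℂ)‖ ^ 2) (Icc 0 t) :=
    ((continuousOn_const.inner (hψ.continuousOn.mono Icc_subset_Ici_self)).norm).pow 2
  have hder : ∀ s ∈ Ioo 0 t,
      HasDerivAt (fun s => ‖(inner ℂ (ψbar k) (ψ s) : ℂ)‖ ^ 2) 0 s := by
    intro s hs
    have h1 := (hψ.equation _ _ (hE.eigenfunction k) s hs.1).norm_sq
    convert h1 using 1
    -- The derivative is twice the real part of −iλ_k |z|², which vanishes because λ_k is real.
    rw [inner_smul_left, Complex.inner, Complex.conj_ofReal,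
      show ∀ z : ℂ, -Complex.I * ((eigenvalue V k : ℂ) * z) * starRingEnd ℂ z =
        (eigenvalue V k : ℂ) * (z * starRingEnd ℂ z) * -Complex.I from fun z => by ring,
      Complex.mul_conj, ← Complex.ofReal_mul]
    simp
  -- The equation holds only for positive times; the mean value theorem on [0, t] reaches the
  -- initial datum by continuity.
  obtain ⟨c, -, hc⟩ := exists_hasDerivAt_eq_slope _ _ ht hcont hder
  rw [eq_comm, div_eq_zero_iff, sub_eq_zero, sub_zero, hψ.initial] at hc
  exact (sq_eq_sq₀ (norm_nonneg _) (norm_nonneg _)).1 (hc.resolve_right ht.ne')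

/-- Conservation of energy. -/
theorem energy_eq_of_isSchrodingerSolution {ψ0 : L2 d} {ψ : ℝ → L2 d}
    (hψ : IsSchrodingerSolution V ψ0 ψ) (h0 : energy V ψ0 ≠ ⊤) {t : ℝ} (ht : 0 < t) :
    energy V (ψ t) = energy V ψ0 := by
  obtain ⟨b, hb⟩ := exists_isClosedForm hV
  have hmem : ψ0 ∈ formDomain V := by
    by_contra hc
    exact h0 (if_neg hc)
  obtain ⟨h1, h2⟩ := hb.mem_and_quad_eq (hE.isEigenFamily hV) (eigenvalue_le_of_forall_le hV)
    hE.unbounded (dense_formSubmodule hV) hmem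
    (fun k => norm_inner_eigenfunction_eq hE hψ k ht)
  rw [energy_of_mem h1, energy_of_mem hmem, h2]

end Spectral
/-! ### Quantitative convexity of the entropy -/

section Convexity

/-- Taylor's inequality for a convex function on `[0, 1]` that is possibly discontinuous at the
endpoints, with a subgradient at `0`. -/
theorem add_add_half_le_of_convexOn {k k' : ℝ → ℝ} {Y C : ℝ} (hk : ConvexOn ℝ (Icc 0 1) k)
    (hd : ∀ t ∈ Ioo (0 : ℝ) 1, HasDerivAt k (k' t) t)
    (hdd : ∀ t ∈ Ioo (0 : ℝ) 1, ∃ m, HasDerivAt k' m t ∧ C ≤ m)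
    (hsub : ∀ t ∈ Icc (0 : ℝ) 1, k 0 + Y * t ≤ k t) : k 0 + Y + C / 2 ≤ k 1 := by
  have h0 : (0 : ℝ) ∈ Icc (0 : ℝ) 1 := by simp
  have h1 : (1 : ℝ) ∈ Icc (0 : ℝ) 1 := by simp
  have hmono : MonotoneOn (fun t => k' t - C * t) (Ioo 0 1) := by
    have hder : ∀ t ∈ Ioo (0 : ℝ) 1, ∃ m, HasDerivAt (fun t => k' t - C * t) (m - C * 1) t ∧
        C ≤ m := by
      intro t ht
      obtain ⟨m, hm, hCm⟩ := hdd t ht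
      exact ⟨m, hm.sub ((hasDerivAt_id t).const_mul C), hCm⟩
    refine monotoneOn_of_deriv_nonneg (convex_Ioo 0 1) (fun t ht => ?_) (fun t ht => ?_)
      (fun t ht => ?_)
    · obtain ⟨m, hm, -⟩ := hder t ht
      exact hm.continuousAt.continuousWithinAt
    · rw [interior_Ioo] at ht
      obtain ⟨m, hm, -⟩ := hder t ht
      exact hm.differentiableAt.differentiableWithinAt
    · rw [interior_Ioo] at ht
      obtain ⟨m, hm, hCm⟩ := hder t ht
      rw [hm.deriv]
      linarith
  -- The subgradient at 0 and convexity give Y ≤ k'(x) for every x in (0, 1); monotonicity of k' −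
  -- C·t from x to t, then x → 0, gives the bound without differentiability at 0.
  have hk' : ∀ t ∈ Ioo (0 : ℝ) 1, Y + C * t ≤ k' t := by
    intro t ht
    have hlim : Tendsto (fun x : ℝ => Y + C * t - C * x) (𝓝[>] 0) (𝓝 (Y + C * t - C * 0)) :=
      (Continuous.tendsto (by fun_prop) 0).mono_left nhdsWithin_le_nhds
    rw [mul_zero, sub_zero] at hlim
    refine le_of_tendsto hlim ?_
    filter_upwards [Ioo_mem_nhdsGT ht.1] with x hx
    have hx1 : x ∈ Ioo (0 : ℝ) 1 := ⟨hx.1, hx.2.trans ht.2⟩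
    have h2 := hmono hx1 ht hx.2.le
    have h3 := hk.slope_le_of_hasDerivAt h0 (Ioo_subset_Icc_self hx1) hx.1 (hd x hx1)
    rw [slope_def_field, div_le_iff₀ (by linarith [hx.1])] at h3
    have h4 := hsub x (Ioo_subset_Icc_self hx1)
    have h5 : Y ≤ k' x := le_of_mul_le_mul_right (by linarith) hx.1
    simp only at h2
    linarith
  have hmono2 : MonotoneOn (fun t => k t - k 0 - Y * t - C / 2 * t ^ 2) (Ioo 0 1) := by
    have hder : ∀ t ∈ Ioo (0 : ℝ) 1, HasDerivAt (fun t => k t - k 0 - Y * t - C / 2 * t ^ 2)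
        (k' t - Y * 1 - C / 2 * (2 * t)) t := by
      intro t ht
      have := (((hd t ht).sub_const (k 0)).sub ((hasDerivAt_id t).const_mul Y)).sub
        ((hasDerivAt_pow 2 t).const_mul (C / 2))
      exact this.congr_deriv (by simp)
    refine monotoneOn_of_deriv_nonneg (convex_Ioo 0 1) (fun t ht => ?_) (fun t ht => ?_)
      (fun t ht => ?_)
    · exact (hder t ht).continuousAt.continuousWithinAt
    · rw [interior_Ioo] at ht
      exact (hder t ht).differentiableAt.differentiableWithinAt
    · rw [interior_Ioo] at ht
      rw [(hder t ht).deriv]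
      linarith [hk' t ht]
  have hge : ∀ t ∈ Ioo (0 : ℝ) 1, k 0 + Y * t + C / 2 * t ^ 2 ≤ k t := by
    intro t ht
    have hlim : Tendsto (fun x : ℝ => -(C / 2 * x ^ 2)) (𝓝[>] 0) (𝓝 (-(C / 2 * 0 ^ 2))) :=
      (Continuous.tendsto (by fun_prop) 0).mono_left nhdsWithin_le_nhds
    have : -(C / 2 * (0 : ℝ) ^ 2) ≤ k t - k 0 - Y * t - C / 2 * t ^ 2 := by
      refine le_of_tendsto hlim ?_
      filter_upwards [Ioo_mem_nhdsGT ht.1] with x hx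
      have hx1 : x ∈ Ioo (0 : ℝ) 1 := ⟨hx.1, hx.2.trans ht.2⟩
      refine le_trans ?_ (hmono2 hx1 ht hx.2.le)
      have := hsub x (Ioo_subset_Icc_self hx1)
      simp only
      linarith
    linarith
  -- Continuity at 1 is replaced by the chord bound k(t) ≤ (1 − t) k(0) + t k(1): divide by t and
  -- let t → 1.
  have hlim : Tendsto (fun x : ℝ => k 0 + Y + C / 2 * x) (𝓝[<] 1) (𝓝 (k 0 + Y + C / 2 * 1)) :=
    (Continuous.tendsto (by fun_prop) 1).mono_left nhdsWithin_le_nhds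
  rw [mul_one] at hlim
  refine le_of_tendsto hlim ?_
  filter_upwards [Ioo_mem_nhdsLT (zero_lt_one (α := ℝ))] with t ht
  have h2 := hge t ht
  have h3 := hk.2 h0 h1 (sub_nonneg.2 ht.2.le) ht.1.le (by ring)
  simp only [smul_eq_mul, mul_zero, mul_one, zero_add] at h3
  refine le_of_mul_le_mul_right (a := t) ?_ ht.1
  nlinarith

/-- On the segment from s to r, p ≤ 2 gives β''(x) ≥ α x^(p−2) ≥ α max(r, s)^(p−2), and Taylor's
inequality applies. For r ≠ s the open segment lies in the interior of D, even when r or s is an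
endpoint of D. -/
theorem bregman_lower_bound {D : Set ℝ} {β : ℝ → ℝ} {p α y r s : ℝ} (hβ : IsEntropyFunction D β)
    (hα : IsConvexityConstant D β p α) (hα0 : 0 ≤ α) (hp : p ≤ 2) (hs : IsDerivInverse D β y s)
    (hr : r ∈ D) (hrs : r ≠ s) :
    α / 2 * (r - s) ^ 2 * max r s ^ (p - 2) ≤ β r - β s - y * (r - s) := by
  have hconv := hβ.strictConvex.1
  have hsD := hs.1
  have hrs' : r - s ≠ 0 := sub_ne_zero.2 hrs
  have hmem : ∀ t ∈ Icc (0 : ℝ) 1, s + t * (r - s) ∈ D := by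
    intro t ht
    have := hconv hsD hr (sub_nonneg.2 ht.2) ht.1 (by ring)
    convert this using 1
    simp only [smul_eq_mul]
    ring
  have hint : ∀ t ∈ Ioo (0 : ℝ) 1, s + t * (r - s) ∈ interior D := by
    intro t ht
    rw [mem_interior_iff_mem_nhds]
    have hoc := hconv.ordConnected
    rcases lt_or_gt_of_ne hrs with h | h
    · exact mem_of_superset (Icc_mem_nhds (a := r) (b := s) (by nlinarith [ht.2])
        (by nlinarith [ht.1])) (hoc.out hr hsD)
    · exact mem_of_superset (Icc_mem_nhds (a := s) (b := r) (by nlinarith [ht.1])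
        (by nlinarith [ht.2])) (hoc.out hsD hr)
  have hline : ∀ t : ℝ, HasDerivAt (fun t => s + t * (r - s)) (r - s) t := fun t => by
    simpa using ((hasDerivAt_id t).mul_const (r - s)).const_add s
  have h := add_add_half_le_of_convexOn (k := fun t => β (s + t * (r - s)))
    (k' := fun t => deriv β (s + t * (r - s)) * (r - s)) (Y := y * (r - s))
    (C := α * max r s ^ (p - 2) * (r - s) ^ 2) ?_ ?_ ?_ ?_
  · simp only [zero_mul, add_zero, one_mul, add_sub_cancel] at h
    linarith
  · refine ⟨convex_Icc 0 1, fun t ht u hu a b ha hb hab => ?_⟩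
    have := hβ.strictConvex.convexOn.2 (hmem t ht) (hmem u hu) ha hb hab
    convert this using 2
    simp only [smul_eq_mul]
    linear_combination (-s) * hab
  · intro t ht
    have hd : DifferentiableAt ℝ β (s + t * (r - s)) :=
      ((hβ.contDiff.differentiableOn (by norm_num)) _ (hint t ht)).differentiableAt
        (isOpen_interior.mem_nhds (hint t ht))
    exact hd.hasDerivAt.comp t (hline t)
  · intro t ht
    refine ⟨_, ((hα.differentiable_deriv _ (hint t ht)).hasDerivAt.comp t
      (hline t)).mul_const (r - s), ?_⟩
    set x := s + t * (r - s) with hx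
    have hx0 : 0 < x := by
      have := interior_mono hβ.nonneg (hint t ht)
      rwa [interior_Ici] at this
    have hxM : x ≤ max r s := by
      rcases le_total r s with h | h
      · exact le_max_of_le_right (by nlinarith [ht.1])
      · exact le_max_of_le_left (by nlinarith [ht.2])
    have h1 : α ≤ deriv (deriv β) x * x ^ (2 - p) :=
      hα.isGLB.1 (mem_image_of_mem _ (hint t ht))
    have h2 : α * x ^ (p - 2) ≤ deriv (deriv β) x := by
      have := mul_le_mul_of_nonneg_right h1 (Real.rpow_nonneg hx0.le (p - 2))
      rwa [mul_assoc, ← Real.rpow_add hx0, show 2 - p + (p - 2) = 0 by ring, Real.rpow_zero,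
        mul_one] at this
    have h3 : max r s ^ (p - 2) ≤ x ^ (p - 2) :=
      Real.rpow_le_rpow_of_nonpos hx0 hxM (by linarith)
    have h4 : α * max r s ^ (p - 2) ≤ deriv (deriv β) x :=
      (mul_le_mul_of_nonneg_left h3 hα0).trans h2
    calc α * max r s ^ (p - 2) * (r - s) ^ 2 ≤ deriv (deriv β) x * (r - s) ^ 2 :=
          mul_le_mul_of_nonneg_right h4 (sq_nonneg _)
      _ = deriv (deriv β) x * (r - s) * (r - s) := by ring
  · intro t ht
    have := hs.2 _ (hmem t ht)
    simp only [zero_mul, add_zero]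
    linarith

end Convexity

/-! ### A Csiszár–Kullback inequality in `ℓ^p` -/

section CsiszarKullback

theorem tsum_enorm_rpow_ne_top {p : ℝ} {x : ℕ → ℝ} (hx : ∀ i, 0 ≤ x i)
    (hp : 0 ≤ p) (hs : Summable fun i => x i ^ p) : ∑' i, ‖x i‖ₑ ^ p ≠ ⊤ := by
  have : ∀ i, ‖x i‖ₑ ^ p = ENNReal.ofReal (x i ^ p) := fun i => by
    rw [Real.enorm_of_nonneg (hx i), ENNReal.ofReal_rpow_of_nonneg (hx i) hp]
  simp_rw [this]
  exact hs.tsum_ofReal_ne_top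

/-- Where x ≤ 2y, compare with y^p. Where x > 2y, the maximum is x and x ≤ 2(x − y), so x^p = x²
x^(p−2) ≤ (4/c) e. -/
theorem summable_rpow_of_summable_bregman {p c : ℝ} (hp : 0 ≤ p) (hc : 0 < c) {x y e : ℕ → ℝ}
    (hx : ∀ i, 0 ≤ x i) (hy : ∀ i, 0 ≤ y i) (he : ∀ i, 0 ≤ e i)
    (h : ∀ i, x i ≠ y i → c * (x i - y i) ^ 2 * max (x i) (y i) ^ (p - 2) ≤ e i)
    (hes : Summable e) (hys : Summable fun i => y i ^ p) : Summable fun i => x i ^ p := by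
  refine Summable.of_nonneg_of_le (fun i => Real.rpow_nonneg (hx i) p) (fun i => ?_)
    ((hys.mul_left (2 ^ p)).add (hes.mul_left (4 / c)))
  rcases le_or_gt (x i) (2 * y i) with hxy | hxy
  · have h1 : x i ^ p ≤ 2 ^ p * y i ^ p := by
      rw [← Real.mul_rpow zero_le_two (hy i)]
      exact Real.rpow_le_rpow (hx i) hxy hp
    have h2 : 0 ≤ 4 / c * e i := mul_nonneg (by positivity) (he i)
    linarith
  · have hy0 := hy i
    have hx0 : 0 < x i := by linarith
    have h1 := h i (by intro h; linarith)
    rw [max_eq_left (by linarith)] at h1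
    have h2 : x i ^ p = x i ^ 2 * x i ^ (p - 2) := by
      rw [← Real.rpow_two, ← Real.rpow_add hx0]; congr 1; ring
    have h3 : x i ^ 2 ≤ 4 * (x i - y i) ^ 2 := by nlinarith
    have h4 : x i ^ p ≤ 4 / c * e i := by
      rw [div_mul_eq_mul_div, le_div_iff₀ hc, h2]
      have := mul_le_mul_of_nonneg_right h3 (mul_nonneg (Real.rpow_nonneg hx0.le (p - 2)) hc.le)
      nlinarith
    have h5 : 0 ≤ 2 ^ p * y i ^ p := by positivity
    linarith

/-- Reversed Hölder inequality with the weight `m ^ (p - 2)`. -/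
theorem rpow_tsum_mul_rpow_tsum_le {p : ℝ} (hp : p ∈ Icc (1 : ℝ) 2) {f m : ℕ → ℝ≥0∞}
    (hfm : ∀ i, f i ≤ m i) (hm : ∑' i, m i ^ p ≠ ⊤) :
    (∑' i, f i ^ p) ^ (2 / p) * (∑' i, m i ^ p) ^ ((p - 2) / p) ≤
      ∑' i, f i ^ 2 * m i ^ (p - 2) := by
  have hp0 : 0 < p := zero_lt_one.trans_le hp.1
  rcases hp.2.eq_or_lt with rfl | hp2
  · simp
  have hp2' : 0 < 2 - p := sub_pos.2 hp2
  have hmi : ∀ i, m i ≠ ⊤ := fun i hi => hm (by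
    rw [← top_le_iff]
    refine le_trans ?_ (ENNReal.le_tsum i)
    rw [hi, ENNReal.top_rpow_of_pos hp0])
  -- Hölder with exponents 2/p and 2/(2 − p) is applied to this factorization, in which the powers
  -- of m cancel.
  have hpt : ∀ i, f i ^ p ≤ (f i ^ 2 * m i ^ (p - 2)) ^ (p / 2) * (m i ^ p) ^ ((2 - p) / 2) := by
    intro i
    rcases eq_or_ne (m i) 0 with h0 | h0
    · have : f i = 0 := le_antisymm ((hfm i).trans h0.le) zero_le
      rw [this, ENNReal.zero_rpow_of_pos hp0]
      exact zero_le
    · rw [ENNReal.mul_rpow_of_nonneg _ _ (by positivity), ← ENNReal.rpow_two, ← ENNReal.rpow_mul,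
        ← ENNReal.rpow_mul, ← ENNReal.rpow_mul, mul_assoc, ← ENNReal.rpow_add _ _ h0 (hmi i),
        show (p - 2) * (p / 2) + p * ((2 - p) / 2) = 0 by ring, ENNReal.rpow_zero, mul_one,
        show 2 * (p / 2) = p by ring]
  have hconj : (2 / p).HolderConjugate (2 / (2 - p)) := by
    rw [Real.holderConjugate_iff]
    refine ⟨by rw [lt_div_iff₀ hp0]; linarith, ?_⟩
    field_simp
    ring
  have hH := ENNReal.lintegral_mul_le_Lp_mul_Lq (Measure.count : Measure ℕ) hconj
    (f := fun i => (f i ^ 2 * m i ^ (p - 2)) ^ (p / 2)) (g := fun i => (m i ^ p) ^ ((2 - p) / 2))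
    measurable_from_top.aemeasurable measurable_from_top.aemeasurable
  simp only [Pi.mul_apply, lintegral_count, one_div_div] at hH
  have hF : ∀ i, ((f i ^ 2 * m i ^ (p - 2)) ^ (p / 2)) ^ (2 / p) = f i ^ 2 * m i ^ (p - 2) := by
    intro i
    rw [← ENNReal.rpow_mul, show p / 2 * (2 / p) = 1 by field_simp, ENNReal.rpow_one]
  have hG : ∀ i, ((m i ^ p) ^ ((2 - p) / 2)) ^ (2 / (2 - p)) = m i ^ p := by
    intro i
    rw [← ENNReal.rpow_mul _ ((2 - p) / 2), show (2 - p) / 2 * (2 / (2 - p)) = 1 by field_simp,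
      ENNReal.rpow_one]
  simp_rw [hF, hG] at hH
  have hA := ENNReal.rpow_le_rpow ((ENNReal.tsum_le_tsum hpt).trans hH)
    (z := 2 / p) (by positivity)
  set A := ∑' i, f i ^ p
  set B := ∑' i, f i ^ 2 * m i ^ (p - 2)
  set M := ∑' i, m i ^ p with hM
  rw [ENNReal.mul_rpow_of_nonneg _ _ (by positivity), ← ENNReal.rpow_mul, ← ENNReal.rpow_mul,
    show p / 2 * (2 / p) = 1 by field_simp, ENNReal.rpow_one,
    show (2 - p) / 2 * (2 / p) = (2 - p) / p by field_simp] at hA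
  -- If M = 0, its negative power is ∞, but then Σ f^p vanishes too and the product is 0.
  rcases eq_or_ne M 0 with h0 | h0
  · have hexp : 0 < (2 - p) / p := by positivity
    rw [h0, ENNReal.zero_rpow_of_pos hexp, mul_zero] at hA
    rw [le_antisymm hA (zero_le), zero_mul]
    exact zero_le
  · calc A ^ (2 / p) * M ^ ((p - 2) / p) ≤ B * M ^ ((2 - p) / p) * M ^ ((p - 2) / p) := by gcongr
      _ = B := by
        rw [mul_assoc, ← ENNReal.rpow_add _ _ h0 hm,
          show (2 - p) / p + (p - 2) / p = 0 by ring, ENNReal.rpow_zero, mul_one]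

/-- On each of the sets x > y and x < y the maximum is a single sequence, which serves as the Hölder
weight and yields one of the two norms in the minimum. -/
theorem entropyTerm_le {p α : ℝ} (hp : p ∈ Icc (1 : ℝ) 2) (hα : 0 < α) {x y e : ℕ → ℝ}
    (hx : ∀ i, 0 ≤ x i) (hy : ∀ i, 0 ≤ y i) (he : ∀ i, 0 ≤ e i)
    (h : ∀ i, x i ≠ y i → α / 2 * (x i - y i) ^ 2 * max (x i) (y i) ^ (p - 2) ≤ e i)
    (hes : Summable e) (hxs : Summable fun i => x i ^ p) (hys : Summable fun i => y i ^ p) :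
    entropyTerm p α x y ≤ ENNReal.ofReal (∑' i, e i) := by
  have hp0 : 0 < p := zero_lt_one.trans_le hp.1
  set W := min (lpENorm p x ^ (p - 2)) (lpENorm p y ^ (p - 2)) with hW
  have hsub : ∀ i, ‖x i - y i‖ₑ ^ p =
      ENNReal.ofReal (x i - y i) ^ p + ENNReal.ofReal (y i - x i) ^ p := by
    intro i
    rcases le_total (x i) (y i) with hxy | hxy
    · rw [ENNReal.ofReal_of_nonpos (sub_nonpos.2 hxy), ENNReal.zero_rpow_of_pos hp0, zero_add,
        ← enorm_neg, neg_sub, Real.enorm_of_nonneg (sub_nonneg.2 hxy)]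
    · rw [ENNReal.ofReal_of_nonpos (sub_nonpos.2 hxy), ENNReal.zero_rpow_of_pos hp0, add_zero,
        Real.enorm_of_nonneg (sub_nonneg.2 hxy)]
  have hnorm : ∀ {z : ℕ → ℝ}, (∀ i, 0 ≤ z i) →
      lpENorm p z ^ (p - 2) = (∑' i, ENNReal.ofReal (z i) ^ p) ^ ((p - 2) / p) := by
    intro z hz
    rw [lpENorm, ← ENNReal.rpow_mul, one_div_mul_eq_div]
    simp_rw [fun i => Real.enorm_of_nonneg (hz i)]
  have hfin : ∀ {z : ℕ → ℝ}, (∀ i, 0 ≤ z i) → (Summable fun i => z i ^ p) →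
      ∑' i, ENNReal.ofReal (z i) ^ p ≠ ⊤ := by
    intro z hz hzs
    have := tsum_enorm_rpow_ne_top hz hp0.le hzs
    simpa only [fun i => Real.enorm_of_nonneg (hz i)] using this
  have h1 := rpow_tsum_mul_rpow_tsum_le hp (f := fun i => ENNReal.ofReal (x i - y i))
    (m := fun i => ENNReal.ofReal (x i))
    (fun i => ENNReal.ofReal_le_ofReal (by linarith [hy i])) (hfin hx hxs)
  have h2 := rpow_tsum_mul_rpow_tsum_le hp (f := fun i => ENNReal.ofReal (y i - x i))
    (m := fun i => ENNReal.ofReal (y i))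
    (fun i => ENNReal.ofReal_le_ofReal (by linarith [hx i])) (hfin hy hys)
  rw [← hnorm hx] at h1
  rw [← hnorm hy] at h2
  set A := ∑' i, ENNReal.ofReal (x i - y i) ^ p
  set B := ∑' i, ENNReal.ofReal (y i - x i) ^ p
  have hpt : ∀ i, ENNReal.ofReal (x i - y i) ^ 2 * ENNReal.ofReal (x i) ^ (p - 2) +
      ENNReal.ofReal (y i - x i) ^ 2 * ENNReal.ofReal (y i) ^ (p - 2) ≤
      ENNReal.ofReal (2 / α * e i) := by
    have key : ∀ a b E : ℝ, 0 ≤ b → b < a → α / 2 * (a - b) ^ 2 * a ^ (p - 2) ≤ E →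
        ENNReal.ofReal (a - b) ^ 2 * ENNReal.ofReal a ^ (p - 2) ≤ ENNReal.ofReal (2 / α * E) := by
      intro a b E hb hab hE
      rw [ENNReal.ofReal_rpow_of_pos (hb.trans_lt hab), ← ENNReal.ofReal_pow (by linarith),
        ← ENNReal.ofReal_mul (by positivity)]
      refine ENNReal.ofReal_le_ofReal ?_
      rw [div_mul_eq_mul_div, le_div_iff₀ hα]
      linarith
    intro i
    rcases lt_trichotomy (x i) (y i) with hxy | hxy | hxy
    · rw [ENNReal.ofReal_of_nonpos (sub_nonpos.2 hxy.le), zero_pow two_ne_zero, zero_mul, zero_add]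
      refine key _ _ _ (hx i) hxy ?_
      have := h i hxy.ne
      rw [max_eq_right hxy.le] at this
      rwa [← neg_sub, neg_sq]
    · simp [hxy]
    · rw [ENNReal.ofReal_of_nonpos (sub_nonpos.2 hxy.le), zero_pow two_ne_zero, zero_mul, add_zero]
      refine key _ _ _ (hy i) hxy ?_
      have := h i hxy.ne'
      rwa [max_eq_left hxy.le] at this
  have hsum : A ^ (2 / p) * W + B ^ (2 / p) * W ≤ ENNReal.ofReal (2 / α * ∑' i, e i) := by
    calc A ^ (2 / p) * W + B ^ (2 / p) * W
        ≤ A ^ (2 / p) * lpENorm p x ^ (p - 2) + B ^ (2 / p) * lpENorm p y ^ (p - 2) := by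
          gcongr
          · exact min_le_left _ _
          · exact min_le_right _ _
      _ ≤ _ := add_le_add h1 h2
      _ = _ := ENNReal.tsum_add.symm
      _ ≤ ∑' i, ENNReal.ofReal (2 / α * e i) := ENNReal.tsum_le_tsum hpt
      _ = ENNReal.ofReal (2 / α * ∑' i, e i) := by
          rw [← ENNReal.ofReal_tsum_of_nonneg
            (fun i => mul_nonneg (by positivity) (he i)) (hes.mul_left _), tsum_mul_left]
  have hAB : lpENorm p (fun i => x i - y i) ^ 2 = (A + B) ^ (2 / p) := by
    rw [lpENorm, ← ENNReal.rpow_two, ← ENNReal.rpow_mul, one_div_mul_eq_div]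
    simp_rw [hsub]
    rw [ENNReal.tsum_add]
  -- Recombining the two sets by convexity of t^(2/p) costs 2^(2/p−1); with the 1/2 from Taylor's
  -- inequality this accounts for the constant 2^(−2/p).
  have hpow := ENNReal.rpow_add_le_mul_rpow_add_rpow A B (p := 2 / p)
    (by rw [le_div_iff₀ hp0]; linarith [hp.2])
  have h2p : (2 : ℝ≥0∞) ^ (2 / p - 1) = ENNReal.ofReal ((2 : ℝ) ^ (2 / p - 1)) := by
    rw [← ENNReal.ofReal_rpow_of_pos two_pos, ENNReal.ofReal_ofNat]
  rw [entropyTerm, hAB]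
  calc ENNReal.ofReal ((2 : ℝ) ^ (-2 / p) * α) * (A + B) ^ (2 / p) * W
      ≤ ENNReal.ofReal ((2 : ℝ) ^ (-2 / p) * α) *
        (2 ^ (2 / p - 1) * (A ^ (2 / p) + B ^ (2 / p))) * W := by gcongr
    _ = ENNReal.ofReal ((2 : ℝ) ^ (-2 / p) * α) * 2 ^ (2 / p - 1) *
        (A ^ (2 / p) * W + B ^ (2 / p) * W) := by ring
    _ ≤ ENNReal.ofReal ((2 : ℝ) ^ (-2 / p) * α) * 2 ^ (2 / p - 1) *
        ENNReal.ofReal (2 / α * ∑' i, e i) := by gcongr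
    _ = ENNReal.ofReal (∑' i, e i) := by
        rw [h2p, ← ENNReal.ofReal_mul (by positivity), ← ENNReal.ofReal_mul (by positivity)]
        congr 1
        have : (2 : ℝ) ^ (-2 / p) * 2 ^ (2 / p - 1) = 1 / 2 := by
          rw [← Real.rpow_add two_pos, show -2 / p + (2 / p - 1) = -1 by ring, Real.rpow_neg_one]
          norm_num
        calc (2 : ℝ) ^ (-2 / p) * α * 2 ^ (2 / p - 1) * (2 / α * ∑' i, e i)
            = (2 : ℝ) ^ (-2 / p) * 2 ^ (2 / p - 1) * (α * (2 / α)) * ∑' i, e i := by ring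
          _ = ∑' i, e i := by rw [this]; field_simp

end CsiszarKullback
/-! ### Weighted sums of energies -/

/-- Abel summation against a nonincreasing nonnegative weight. -/
theorem sum_mul_nonneg_of_antitone {w a : ℕ → ℝ} (hw : Antitone w) (hw0 : ∀ i, 0 ≤ w i)
    (ha : ∀ n, (∀ i < n, w i ≠ 0) → 0 ≤ ∑ i ∈ Finset.range n, a i) (n : ℕ) :
    0 ≤ ∑ i ∈ Finset.range n, w i * a i := by
  -- Partial sums of a are controlled only while the weights are nonzero, since beyond that point
  -- energies may be infinite. Once a weight vanishes, so do all later ones, and nothing more is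
  -- added.
  have key : ∀ n, (∀ i < n, w i ≠ 0) →
      w n * ∑ i ∈ Finset.range n, a i ≤ ∑ i ∈ Finset.range n, w i * a i := by
    intro n
    induction n with
    | zero => simp
    | succ n ih =>
      intro hn
      have h1 := ih fun i hi => hn i (by omega)
      have h2 := mul_le_mul_of_nonneg_right (hw n.le_succ) (ha (n + 1) hn)
      rw [Finset.sum_range_succ] at h2 ⊢
      rw [Finset.sum_range_succ]
      rw [mul_add (w n)] at h2
      exact h2.trans (by linarith)
  induction n with
  | zero => simp
  | succ n ih =>
    by_cases hn : w n = 0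
    · rwa [Finset.sum_range_succ, hn, zero_mul, add_zero]
    · have h : ∀ i < n + 1, w i ≠ 0 := fun i hi h0 =>
        hn (le_antisymm ((hw (Nat.lt_succ_iff.1 hi)).trans h0.le) (hw0 n))
      exact (mul_nonneg (hw0 _) (ha _ h)).trans (key _ h)

/-- Only finitely many l_i are negative; past them the terms are nonnegative, with partial sums
bounded through Σ |w_i E_i|. -/
theorem summable_mul_of_sum_le {w l E : ℕ → ℝ} (hw0 : ∀ i, 0 ≤ w i) (hl : Monotone l)
    (hlu : ¬ BddAbove (range l)) (hE : Summable fun i => w i * E i)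
    (h : ∀ n, 0 ≤ ∑ i ∈ Finset.range n, w i * (E i - l i)) : Summable fun i => w i * l i := by
  obtain ⟨N, hN⟩ : ∃ N, 0 ≤ l N := by
    by_contra! hc
    exact hlu ⟨0, by rintro _ ⟨i, rfl⟩; exact (hc i).le⟩
  rw [← summable_nat_add_iff N]
  refine summable_of_sum_range_le (c := ∑' i, |w i * E i| - ∑ i ∈ Finset.range N, w i * l i)
    (fun n => mul_nonneg (hw0 _) (hN.trans (hl (by omega)))) (fun n => ?_)
  have h1 := h (N + n)
  simp_rw [mul_sub, Finset.sum_sub_distrib] at h1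
  rw [Finset.sum_range_add (fun i => w i * l i)] at h1
  have h2 : ∑ i ∈ Finset.range (N + n), w i * E i ≤ ∑' i, |w i * E i| :=
    (Finset.sum_le_sum fun i _ => le_abs_self _).trans
      (hE.abs.sum_le_tsum _ fun i _ => abs_nonneg _)
  simp_rw [add_comm _ N]
  linarith

end MixedStates

/-! ### The stability inequality -/

open MixedStates

theorem mainTheorem11 {d : ℕ} (hd : 0 < d)
    (D : Set ℝ) (β : ℝ → ℝ) (V : MixedStates.Space d → ℝ)
    (νbar : ℕ → ℝ) (ψbar : ℕ → MixedStates.L2 d)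
    (hH : MixedStates.AssumptionH D β V νbar ψbar)
    (p α : ℝ) (hp : p ∈ Set.Icc (1 : ℝ) 2) (hα : 0 < α)
    (hβα : MixedStates.IsConvexityConstant D β p α)
    (ν : ℕ → ℝ) (hν : ν ∈ MixedStates.occupationNumbers D β)
    (ψ0 : ℕ → MixedStates.L2 d) (hψ0 : Orthonormal ℂ ψ0)
    (hfin : MixedStates.HasFiniteEnergy V ν ψ0)
    (ψ : ℕ → ℝ → MixedStates.L2 d)
    (hψ : ∀ j, MixedStates.IsSchrodingerSolution V (ψ0 j) (ψ j))
    (t : ℝ) (ht : 0 < t) :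
    -- the quantities below are finite
    MixedStates.lpENorm p ν ≠ ⊤ ∧ MixedStates.lpENorm p νbar ≠ ⊤ ∧
    MixedStates.HasFiniteEnergy V νbar ψbar ∧
    MixedStates.HasFiniteEnergy V ν (fun i => ψ i t) ∧
    Summable (fun i =>
      ν i * ((MixedStates.energy V (ψ i t)).toReal - MixedStates.eigenvalue V i)) ∧
    -- both terms are nonnegative
    (0 : EReal) ≤ (MixedStates.entropyTerm p α ν νbar : EReal) ∧
    0 ≤ ∑' i, ν i * ((MixedStates.energy V (ψ i t)).toReal - MixedStates.eigenvalue V i) ∧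
    -- the stability inequality
    (MixedStates.entropyTerm p α ν νbar : EReal) +
        ((∑' i, ν i * ((MixedStates.energy V (ψ i t)).toReal -
          MixedStates.eigenvalue V i) : ℝ) : EReal) ≤
      ((MixedStates.freeEnergy β V ν ψ0 - MixedStates.freeEnergy β V νbar ψbar : ℝ) : EReal) := by
  obtain ⟨hβ, hV, hE, hocc, hsβbar, hsνbar⟩ := hH
  obtain ⟨hanti, hν0, -, hνD, hsβ⟩ := hν
  obtain ⟨hfin1, hfin2⟩ := hfin
  have hp0 : 0 < p := zero_lt_one.trans_le hp.1
  have hνbar0 : ∀ i, 0 ≤ νbar i := fun i => hβ.nonneg (hocc i).1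
  have hlp : ∀ x : ℕ → ℝ, (∀ i, 0 ≤ x i) → (Summable fun i => x i ^ p) → lpENorm p x ≠ ⊤ :=
    fun x hx hs => ENNReal.rpow_ne_top_of_nonneg (by positivity)
      (tsum_enorm_rpow_ne_top hx hp0.le hs)
  -- energies
  have hbar : ∀ i, energy V (ψbar i) = (eigenvalue V i : ℝ) := energy_eigenfunction hV hE
  have hcons : ∀ i, ν i ≠ 0 → energy V (ψ i t) = energy V (ψ0 i) := fun i hi =>
    energy_eq_of_isSchrodingerSolution hV hE (hψ i) (hfin1 i hi) ht
  -- When ν_i = 0 the energy may be infinite and need not be compared; the product is 0 in any case.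
  have hcons' : ∀ i, ν i * (energy V (ψ i t)).toReal = ν i * (energy V (ψ0 i)).toReal := by
    intro i
    rcases eq_or_ne (ν i) 0 with hi | hi
    · simp [hi]
    · rw [hcons i hi]
  have hpartial : ∀ n, 0 ≤ ∑ i ∈ Finset.range n,
      ν i * ((energy V (ψ0 i)).toReal - eigenvalue V i) := by
    refine sum_mul_nonneg_of_antitone hanti hν0 fun n hn => ?_
    rw [Finset.sum_sub_distrib, sub_nonneg]
    exact sum_eigenvalue_le_sum_energy hV hE n hψ0 fun i hi => hfin1 i (hn i hi)
  have hsl : Summable fun i => ν i * eigenvalue V i :=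
    summable_mul_of_sum_le hν0 (eigenvalue_monotone hV hE) hE.unbounded hfin2 hpartial
  have hdiff : ∀ i, ν i * ((energy V (ψ i t)).toReal - eigenvalue V i) =
      ν i * (energy V (ψ0 i)).toReal - ν i * eigenvalue V i := fun i => by
    rw [mul_sub, hcons']
  have hsdiff : Summable fun i => ν i * ((energy V (ψ i t)).toReal - eigenvalue V i) :=
    (hfin2.sub hsl).congr fun i => (hdiff i).symm
  have hdiff0 : 0 ≤ ∑' i, ν i * ((energy V (ψ i t)).toReal - eigenvalue V i) := by
    refine ge_of_tendsto' hsdiff.hasSum.tendsto_sum_nat fun n => ?_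
    refine (hpartial n).trans_eq (Finset.sum_congr rfl fun i _ => ?_)
    rw [hdiff, mul_sub]
  -- relative entropies
  have hbreg : ∀ i, ∀ r ∈ D, 0 ≤ β r - β (νbar i) + eigenvalue V i * (r - νbar i) := by
    intro i r hr
    have := (hocc i).2 r hr
    linarith
  have hbreg2 : ∀ i, ∀ r ∈ D, r ≠ νbar i → α / 2 * (r - νbar i) ^ 2 * max r (νbar i) ^ (p - 2) ≤
      β r - β (νbar i) + eigenvalue V i * (r - νbar i) := by
    intro i r hr hne
    have := bregman_lower_bound hβ hβα hα.le hp.2 (hocc i) hr hne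
    linarith
  have hsbar : Summable fun i => νbar i ^ p := by
    -- Comparison with r = 0: the relative entropy of 0 with respect to ν̄_i is −β(ν̄_i) − λ_i ν̄_i,
    -- summable by (H).
    refine summable_rpow_of_summable_bregman (y := 0) hp0.le (half_pos hα) hνbar0 (fun _ => le_rfl)
      (fun i => hbreg i 0 hβ.zero_mem) (fun i hi => ?_) ?_ ?_
    · have := hbreg2 i 0 hβ.zero_mem hi.symm
      rwa [max_comm, sub_sq_comm] at this
    · refine (hsβbar.neg.sub hsνbar).congr fun i => ?_
      rw [hβ.map_zero]
      ring
    · simp [Real.zero_rpow hp0.ne', summable_zero]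
  have hse : Summable fun i => β (ν i) - β (νbar i) + eigenvalue V i * (ν i - νbar i) := by
    refine ((hsβ.sub hsβbar).add (hsl.sub hsνbar)).congr fun i => ?_
    ring
  have hsν : Summable fun i => ν i ^ p :=
    summable_rpow_of_summable_bregman hp0.le (half_pos hα) hν0 hνbar0
      (fun i => hbreg i _ (hνD i)) (fun i => hbreg2 i _ (hνD i)) hse hsbar
  have hent := entropyTerm_le hp hα hν0 hνbar0 (fun i => hbreg i _ (hνD i))
    (fun i => hbreg2 i _ (hνD i)) hse hsν hsbar
  -- The terms ν_i λ_i inserted in both series cancel; the conserved energy allows time t in place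
  -- of time 0.
  have hfree : freeEnergy β V ν ψ0 - freeEnergy β V νbar ψbar =
      ∑' i, (β (ν i) - β (νbar i) + eigenvalue V i * (ν i - νbar i)) +
        ∑' i, ν i * ((energy V (ψ i t)).toReal - eigenvalue V i) := by
    have h1 : ∑' i, (β (ν i) - β (νbar i) + eigenvalue V i * (ν i - νbar i)) =
        (∑' i, β (ν i) - ∑' i, β (νbar i)) +
          (∑' i, ν i * eigenvalue V i - ∑' i, νbar i * eigenvalue V i) := by
      rw [← hsβ.tsum_sub hsβbar, ← hsl.tsum_sub hsνbar,
        ← (hsβ.sub hsβbar).tsum_add (hsl.sub hsνbar)]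
      exact tsum_congr fun i => by ring
    have h2 : ∑' i, ν i * ((energy V (ψ i t)).toReal - eigenvalue V i) =
        ∑' i, ν i * (energy V (ψ0 i)).toReal - ∑' i, ν i * eigenvalue V i := by
      rw [← hfin2.tsum_sub hsl]
      exact tsum_congr hdiff
    rw [h1, h2, freeEnergy, freeEnergy]
    simp_rw [hbar, EReal.toReal_coe]
    ring
  refine ⟨hlp ν hν0 hsν, hlp νbar hνbar0 hsbar, ⟨fun i _ => ?_, ?_⟩, ⟨fun i hi => ?_, ?_⟩,
    hsdiff, EReal.coe_ennreal_nonneg _, hdiff0, ?_⟩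
  · rw [hbar]
    exact EReal.coe_ne_top _
  · simpa only [hbar, EReal.toReal_coe] using hsνbar
  · rw [hcons i hi]
    exact hfin1 i hi
  · exact hfin2.congr fun i => (hcons' i).symm
  · rw [hfree, EReal.coe_add]
    refine add_le_add_left ?_ _
    have := EReal.coe_ennreal_le_coe_ennreal_iff.2 hent
    rwa [EReal.coe_ennreal_ofReal, max_eq_left
      (tsum_nonneg fun i => hbreg i _ (hνD i))] at this
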